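/- **Setting.** Let $\mathbb R^3_1$ be $\mathbb R^3$ with the metric $\langle x,y\rangle=x_1y_1+x_2y_2-x_3y_3$ and the standard orientation; a *motion* is an orientation-preserving affine isometry, $x\mapsto Ax+b$ with $\langle Ax,Ay\rangle=\langle x,y\rangle$ and $\det A=1$. A $C^3$ map $z=z(u,v)$ on an open set $U\subseteq\mathbb R^2$ is a *time-like surface in principal parameters* if $$E=\langle z_u,z_u\rangle<0,\quad G=\langle z_v,z_v\rangle>0,\quad F=\langle z_u,z_v\rangle=0,\quad M=\langle l,z_{uv}\rangle=0,$$ where $l$ is the unit normal for which $(z_u,z_v,l)$ is positively oriented. With $L=\langle l,z_{uu}\rangle$ and $N=\langle l,z_{vv}\rangle$, its principal curvatures and principal geodesic curvatures are $$\nu_1=\frac LE,\quad \nu_2=\frac NG,\quad \gamma_1=\frac{E_v}{2E\sqrt G},\quad \gamma_2=\frac{-G_u}{2G\sqrt{-E}},$$ and it is *strongly regular* if $(\nu_1-\nu_2)\gamma_1\gamma_2\ne0$ everywhere on $U$. A strongly regular such surface with $\nu_1=f(\nu)$, $\nu_2=g(\nu)$ for a function $\nu(u,v)$ is a strongly regular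 time-like *Weingarten surface*, and $(u,v)$ are *natural* principal parameters on it if $$\sqrt{-E}\,\exp\Big(\int_{\nu_0}^{\nu}\frac{f'\,d\nu}{f-g}\Big)\quad\text{and}\quad \sqrt{G}\,\exp\Big(\int_{\nu_0}^{\nu}\frac{g'\,d\nu}{g-f}\Big)$$ are constant. **Theorem.** Let $2\le k\le\infty$, let $\mathcal I\subseteq\mathbb R$ be an open interval, and let $f,g\in C^k(\mathcal I)$ satisfy $f-g\neq0$ and $f'g'\ne0$ on $\mathcal I$. Let $\mathcal D\subseteq\mathbb R^2$ be open, and let $\nu\in C^k(\mathcal D)$ take values in $\mathcal I$ and satisfy $\nu_u\nu_v\neq 0$ on $\mathcal D$. Let $(u_0,v_0)\in\mathcal D$, $\nu_0=\nu(u_0,v_0)$, and let $\mathfrak a\ne0$, $\mathfrak b\neq0$ be real constants such that on $\mathcal D$ $$\mathfrak a^2 \exp\Big(2\int_{\nu_0}^{\nu}\frac{f'\,d\nu}{f-g}\Big)\Big[g'\nu_{uu}+\Big(g''-\frac{2g'^2}{g-f}\Big)\nu_u^2\Big]+\mathfrak b^2 \exp\Big(2\int_{\nu_0}^{\nu}\frac{g'\,d\nu}{g-f}\Big)\Big[f'\nu_{vv}+\Big(f''-\frac{2f'^2}{f-g}\Big)\nu_v^2\Big]=fg(f-g).$$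 For an open set $U\subseteq\mathcal D$ call $z:U\to\mathbb R^3_1$ a *solution on* $U$ if it is a strongly regular time-like Weingarten surface in principal parameters $(u,v)$ with $$\nu_1=f(\nu),\quad \nu_2=g(\nu),\quad \gamma_1=\exp\Big(\int_{\nu_0}^{\nu}\frac{g'\,d\nu}{g-f}\Big)\frac{-|\mathfrak b|\,f'}{f-g}\,\nu_v,\quad \gamma_2=\exp\Big(\int_{\nu_0}^{\nu}\frac{f'\,d\nu}{f-g}\Big)\frac{-|\mathfrak a|\,g'}{f-g}\,\nu_u .$$ Then: 1. there is a connected open set $\mathcal D_0\subseteq\mathcal D$ containing $(u_0,v_0)$ and a solution on $\mathcal D_0$ of class $C^{k+1}$; 2. for every connected open set $\mathcal D_1\subseteq\mathcal D$, any two solutions $z,w$ on $\mathcal D_1$ differ by a motion: $w=T\circ z$ for some motion $T$; 3. on every solution on a connected open set $\mathcal D_1\subseteq\mathcal D$, $(u,v)$ are natural principal parameters. -/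

import Mathlib

open Set

noncomputable section

namespace Minkowski

/-- The underlying real vector space of Minkowski space `ℝ³₁`, with coordinates with respect to
the fixed basis `e₁, e₂, e₃`. -/
abbrev R31 : Type := Fin 3 → ℝ

/-- The flat metric of signature `(2,1)`: `e₁² = e₂² = 1`, `e₃² = -1`. -/
def ip (x y : R31) : ℝ := x 0 * y 0 + x 1 * y 1 - x 2 * y 2

/-- The Lorentzian vector product: the vector with `ip (cross x y) w = det (x, y, w)`
for every `w`. -/
def cross (x y : R31) : R31 :=
  ![crossProduct x y 0, crossProduct x y 1, -(crossProduct x y 2)]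

/-- Motions of `ℝ³₁`: orientation-preserving affine isometries of the metric. -/
def IsMotion (T : R31 → R31) : Prop :=
  ∃ (A : Matrix (Fin 3) (Fin 3) ℝ) (b : R31),
    A.det = 1 ∧ (∀ x y, ip (A.mulVec x) (A.mulVec y) = ip x y) ∧ ∀ x, T x = A.mulVec x + b

/-- The partial derivative with respect to the first variable `u`. -/
def pu {W : Type*} [NormedAddCommGroup W] [NormedSpace ℝ W] (h : ℝ × ℝ → W) (p : ℝ × ℝ) : W :=
  deriv (fun u => h (u, p.2)) p.1

/-- The partial derivative with respect to the second variable `v`. -/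
def pv {W : Type*} [NormedAddCommGroup W] [NormedSpace ℝ W] (h : ℝ × ℝ → W) (p : ℝ × ℝ) : W :=
  deriv (fun v => h (p.1, v)) p.2

/-! ### Fundamental forms of a parametrized surface `z = z(u,v)` -/

/-- `E = z_u²`. -/
def coefE (z : ℝ × ℝ → R31) (p : ℝ × ℝ) : ℝ := ip (pu z p) (pu z p)

/-- `F = z_u z_v`. -/
def coefF (z : ℝ × ℝ → R31) (p : ℝ × ℝ) : ℝ := ip (pu z p) (pv z p)

/-- `G = z_v²`. -/
def coefG (z : ℝ × ℝ → R31) (p : ℝ × ℝ) : ℝ := ip (pv z p) (pv z p)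

/-- The unit normal `l` for which the frame `z_u, z_v, l` is positively oriented
(on a time-like surface, where `(z_u × z_v)² = F² - EG > 0`). -/
def normal (z : ℝ × ℝ → R31) (p : ℝ × ℝ) : R31 :=
  (Real.sqrt (ip (cross (pu z p) (pv z p)) (cross (pu z p) (pv z p))))⁻¹ •
    cross (pu z p) (pv z p)

/-- `L = l z_uu`. -/
def coefL (z : ℝ × ℝ → R31) (p : ℝ × ℝ) : ℝ := ip (normal z p) (pu (pu z) p)

/-- `M = l z_uv`. -/
def coefM (z : ℝ × ℝ → R31) (p : ℝ × ℝ) : ℝ := ip (normal z p) (pv (pu z) p)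

/-- `N = l z_vv`. -/
def coefN (z : ℝ × ℝ → R31) (p : ℝ × ℝ) : ℝ := ip (normal z p) (pv (pv z) p)

/-! ### Invariants of a surface in principal parameters -/

/-- The first principal curvature `ν₁ = L / E`. -/
def curv1 (z : ℝ × ℝ → R31) (p : ℝ × ℝ) : ℝ := coefL z p / coefE z p

/-- The second principal curvature `ν₂ = N / G`. -/
def curv2 (z : ℝ × ℝ → R31) (p : ℝ × ℝ) : ℝ := coefN z p / coefG z p

/-- The first principal geodesic curvature `γ₁ = E_v / (2 E √G)`. -/
def geod1 (z : ℝ × ℝ → R31) (p : ℝ × ℝ) : ℝ :=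
  pv (coefE z) p / (2 * coefE z p * Real.sqrt (coefG z p))

/-- The second principal geodesic curvature `γ₂ = -G_u / (2 G √(-E))`. -/
def geod2 (z : ℝ × ℝ → R31) (p : ℝ × ℝ) : ℝ :=
  -pu (coefG z) p / (2 * coefG z p * Real.sqrt (-coefE z p))

/-- `z` restricted to `U` is a time-like surface (of class `C³`) parametrized by principal
parameters, the `u`-lines being time-like and the `v`-lines space-like. -/
structure IsPrincipalTimelike (U : Set (ℝ × ℝ)) (z : ℝ × ℝ → R31) : Prop where
  smooth : ContDiffOn ℝ 3 z U
  E_neg : ∀ p ∈ U, coefE z p < 0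
  G_pos : ∀ p ∈ U, 0 < coefG z p
  F_zero : ∀ p ∈ U, coefF z p = 0
  M_zero : ∀ p ∈ U, coefM z p = 0

/-- A strongly regular time-like surface: `(ν₁ - ν₂) γ₁ γ₂ ≠ 0`. -/
structure IsStronglyRegular (U : Set (ℝ × ℝ)) (z : ℝ × ℝ → R31) : Prop
    extends IsPrincipalTimelike U z where
  regular : ∀ p ∈ U, (curv1 z p - curv2 z p) * geod1 z p * geod2 z p ≠ 0

/-- The surface is Weingarten with Weingarten functions `f, g` and the function `ν`. -/
def IsWeingarten (f g : ℝ → ℝ) (ν : ℝ × ℝ → ℝ) (U : Set (ℝ × ℝ)) (z : ℝ × ℝ → R31) : Prop :=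
  ∀ p ∈ U, curv1 z p = f (ν p) ∧ curv2 z p = g (ν p)

/-- `exp (∫_{s₀}^{s} f' dν / (f - g))`. Its companion `exp (∫_{s₀}^{s} g' dν / (g - f))` is
obtained by exchanging `f` and `g`. -/
def weight (f g : ℝ → ℝ) (s₀ s : ℝ) : ℝ := Real.exp (∫ t in s₀..s, deriv f t / (f t - g t))

/-- The parameters `(u, v)` of a Weingarten surface in principal parameters are natural:
`λ = √(-E) exp (∫ f' dν / (f - g))` and `μ = √G exp (∫ g' dν / (g - f))` are constant
(another lower limit `s₀` only rescales `λ` and `μ`). -/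
def IsNatural (f g : ℝ → ℝ) (ν : ℝ × ℝ → ℝ) (s₀ : ℝ) (U : Set (ℝ × ℝ))
    (z : ℝ × ℝ → R31) : Prop :=
  (∃ c : ℝ, ∀ p ∈ U, Real.sqrt (-coefE z p) * weight f g s₀ (ν p) = c) ∧
  (∃ c : ℝ, ∀ p ∈ U, Real.sqrt (coefG z p) * weight g f s₀ (ν p) = c)

/-- The natural partial differential equation at the point `p`, with constants `a, b`. -/
def NaturalPDE (f g : ℝ → ℝ) (ν : ℝ × ℝ → ℝ) (s₀ a b : ℝ) (p : ℝ × ℝ) : Prop :=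
  a ^ 2 * weight f g s₀ (ν p) ^ 2 *
      (deriv g (ν p) * pu (pu ν) p +
        (deriv (deriv g) (ν p) - 2 * deriv g (ν p) ^ 2 / (g (ν p) - f (ν p))) * pu ν p ^ 2) +
    b ^ 2 * weight g f s₀ (ν p) ^ 2 *
      (deriv f (ν p) * pv (pv ν) p +
        (deriv (deriv f) (ν p) - 2 * deriv f (ν p) ^ 2 / (f (ν p) - g (ν p))) * pv ν p ^ 2) =
  f (ν p) * g (ν p) * (f (ν p) - g (ν p))

/-- `z` is, over `U`, a strongly regular time-like Weingarten surface with principal curvatures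
`f(ν)`, `g(ν)` and with the prescribed principal geodesic curvatures. -/
structure IsSolution (f g : ℝ → ℝ) (ν : ℝ × ℝ → ℝ) (s₀ a b : ℝ) (U : Set (ℝ × ℝ))
    (z : ℝ × ℝ → R31) : Prop where
  stronglyRegular : IsStronglyRegular U z
  weingarten : IsWeingarten f g ν U z
  geod1_eq : ∀ p ∈ U, geod1 z p =
    weight g f s₀ (ν p) * (-|b| * deriv f (ν p) / (f (ν p) - g (ν p))) * pv ν p
  geod2_eq : ∀ p ∈ U, geod2 z p =
    weight f g s₀ (ν p) * (-|a| * deriv g (ν p) / (f (ν p) - g (ν p))) * pu ν p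

end Minkowski

end

/-! Write `E = -p²` and `G = q²`, and attach to the surface the orthonormal frame `X = z_u / p`, `Y
= z_v / q`, `l`. Its structure equations form a linear first-order system with coefficients `α = p_v
/ q`, `β = ν₁ p`, `γ = q_u / p`, `δ = ν₂ q`. The integrability conditions of that system are `p_v =
α q` and `q_u = γ p` (closing up of `z`), the Codazzi equations `β_v = δ α` and `δ_u = β γ`, and the
Gauss equation `γ_u = α_v + β δ`.

On a Weingarten surface the Codazzi equations read `p_v / p = -f' ν_v / (f - g)` and `q_u / q = -g'
ν_u / (g - f)`. Each fixes only one partial derivative of `p` or `q`. But `γ₁ = p_v / (p q)`, so `γ₁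
= -f' ν_v / ((f - g) q)`. Comparing this with the prescribed `γ₁` and cancelling `f' ν_v ≠ 0` gives
`q` as a function of `ν`, namely `1 / q = |b| exp (∫ g' / (g - f))`. In the same way `γ₂` gives `1 /
p = |a| exp (∫ f' / (f - g))`. Hence the metric is known (`IsSolution.metric_eq`), and naturality of
the parameters is immediate.

Uniqueness follows, because two solutions have frames with the same structure coefficients. The
linear map carrying one frame to the other is then constant (`frame_transport_constant`), and it is
the linear part of the motion (`FrameField.exists_motion`).

For existence, define `p` and `q` by these formulas. The Codazzi equations then hold identically,
and the Gauss equation multiplied by `(f - g) / (p q)` is the natural equation. A Frobenius theorem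
for linear systems (`exists_solution_of_compatible_linear_system`) produces the frame and the
surface (`exists_frameField`), and `FrameField.invariants` recovers the curvatures. -/

noncomputable section

namespace Minkowski

open scoped Topology

/-! ### Calculus of functions of two variables through their pair of partial derivatives -/

section Partials

variable {W : Type*} [NormedAddCommGroup W] [NormedSpace ℝ W]

/-- `h` is differentiable at `p`, with partial derivatives `hu` and `hv`. -/
def HasPartials (h : ℝ × ℝ → W) (hu hv : W) (p : ℝ × ℝ) : Prop :=
  HasFDerivAt h ((ContinuousLinearMap.fst ℝ ℝ ℝ).smulRight hu +
    (ContinuousLinearMap.snd ℝ ℝ ℝ).smulRight hv) p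

theorem HasPartials.congr_partials {h : ℝ × ℝ → W} {hu hv hu' hv' : W} {p : ℝ × ℝ}
    (H : HasPartials h hu hv p) (eu : hu = hu') (ev : hv = hv') : HasPartials h hu' hv' p := by
  subst eu; subst ev; exact H

theorem _root_.HasFDerivAt.hasPartials {h : ℝ × ℝ → W} {h' : ℝ × ℝ →L[ℝ] W} {p : ℝ × ℝ}
    (H : HasFDerivAt h h' p) : HasPartials h (h' (1, 0)) (h' (0, 1)) p := by
  unfold HasPartials
  convert H using 1
  ext <;> simp

theorem _root_.HasFDerivAt.hasPartials_of_eq {h : ℝ × ℝ → W} {h' : ℝ × ℝ →L[ℝ] W} {p : ℝ × ℝ}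
    {hu hv : W} (H : HasFDerivAt h h' p) (eu : h' (1, 0) = hu) (ev : h' (0, 1) = hv) :
    HasPartials h hu hv p :=
  H.hasPartials.congr_partials eu ev

theorem HasPartials.hasDerivAt_fst {h : ℝ × ℝ → W} {hu hv : W} {p : ℝ × ℝ}
    (H : HasPartials h hu hv p) : HasDerivAt (fun u => h (u, p.2)) hu p.1 := by
  have h1 : HasDerivAt (fun u : ℝ => (u, p.2)) ((1 : ℝ), (0 : ℝ)) p.1 :=
    (hasDerivAt_id p.1).prodMk (hasDerivAt_const p.1 p.2)
  have h2 := HasFDerivAt.comp_hasDerivAt (f := fun u : ℝ => (u, p.2)) p.1 H h1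
  simpa [Function.comp_def] using h2

theorem HasPartials.hasDerivAt_snd {h : ℝ × ℝ → W} {hu hv : W} {p : ℝ × ℝ}
    (H : HasPartials h hu hv p) : HasDerivAt (fun v => h (p.1, v)) hv p.2 := by
  have h1 : HasDerivAt (fun v : ℝ => (p.1, v)) ((0 : ℝ), (1 : ℝ)) p.2 :=
    (hasDerivAt_const p.2 p.1).prodMk (hasDerivAt_id p.2)
  have h2 := HasFDerivAt.comp_hasDerivAt (f := fun v : ℝ => (p.1, v)) p.2 H h1
  simpa [Function.comp_def] using h2

theorem HasPartials.pu_eq {h : ℝ × ℝ → W} {hu hv : W} {p : ℝ × ℝ}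
    (H : HasPartials h hu hv p) : pu h p = hu := H.hasDerivAt_fst.deriv

theorem HasPartials.pv_eq {h : ℝ × ℝ → W} {hu hv : W} {p : ℝ × ℝ}
    (H : HasPartials h hu hv p) : pv h p = hv := H.hasDerivAt_snd.deriv

theorem HasPartials.unique {h : ℝ × ℝ → W} {hu hv hu' hv' : W} {p : ℝ × ℝ}
    (H : HasPartials h hu hv p) (H' : HasPartials h hu' hv' p) : hu = hu' ∧ hv = hv' :=
  ⟨H.pu_eq.symm.trans H'.pu_eq, H.pv_eq.symm.trans H'.pv_eq⟩

theorem _root_.DifferentiableAt.hasPartials {h : ℝ × ℝ → W} {p : ℝ × ℝ}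
    (H : DifferentiableAt ℝ h p) : HasPartials h (pu h p) (pv h p) p := by
  have h1 := H.hasFDerivAt.hasPartials
  exact h1.congr_partials h1.pu_eq.symm h1.pv_eq.symm

theorem HasPartials.congr_on {h h' : ℝ × ℝ → W} {hu hv : W} {p : ℝ × ℝ} {U : Set (ℝ × ℝ)}
    (H : HasPartials h hu hv p) (hU : IsOpen U) (hp : p ∈ U) (e : ∀ x ∈ U, h' x = h x) :
    HasPartials h' hu hv p :=
  HasFDerivAt.congr_of_eventuallyEq H (Filter.eventually_of_mem (hU.mem_nhds hp) e)

theorem hasPartials_const (c : W) (p : ℝ × ℝ) : HasPartials (fun _ => c) 0 0 p := by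
  exact (hasFDerivAt_const c p).hasPartials_of_eq (by simp) (by simp)

theorem HasPartials.add {h k : ℝ × ℝ → W} {hu hv ku kv : W} {p : ℝ × ℝ}
    (H : HasPartials h hu hv p) (K : HasPartials k ku kv p) :
    HasPartials (fun x => h x + k x) (hu + ku) (hv + kv) p :=
  (HasFDerivAt.fun_add H K).hasPartials_of_eq (by simp) (by simp)

theorem HasPartials.sub {h k : ℝ × ℝ → W} {hu hv ku kv : W} {p : ℝ × ℝ}
    (H : HasPartials h hu hv p) (K : HasPartials k ku kv p) :
    HasPartials (fun x => h x - k x) (hu - ku) (hv - kv) p :=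
  (HasFDerivAt.fun_sub H K).hasPartials_of_eq (by simp) (by simp)

theorem HasPartials.neg {h : ℝ × ℝ → W} {hu hv : W} {p : ℝ × ℝ}
    (H : HasPartials h hu hv p) :
    HasPartials (fun x => -h x) (-hu) (-hv) p :=
  (HasFDerivAt.fun_neg H).hasPartials_of_eq (by simp) (by simp)

theorem HasPartials.smul {h : ℝ × ℝ → ℝ} {k : ℝ × ℝ → W} {hu hv : ℝ} {ku kv : W} {p : ℝ × ℝ}
    (H : HasPartials h hu hv p) (K : HasPartials k ku kv p) :
    HasPartials (fun x => h x • k x) (hu • k p + h p • ku) (hv • k p + h p • kv) p :=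
  (HasFDerivAt.fun_smul H K).hasPartials_of_eq (by simp [add_comm]) (by simp [add_comm])

theorem HasPartials.mul {h k : ℝ × ℝ → ℝ} {hu hv ku kv : ℝ} {p : ℝ × ℝ}
    (H : HasPartials h hu hv p) (K : HasPartials k ku kv p) :
    HasPartials (fun x => h x * k x) (hu * k p + h p * ku) (hv * k p + h p * kv) p :=
  HasPartials.smul H K

theorem HasPartials.scomp {F : ℝ → ℝ} {F' : ℝ} {h : ℝ × ℝ → ℝ} {hu hv : ℝ} {p : ℝ × ℝ}
    (hF : HasDerivAt F F' (h p)) (H : HasPartials h hu hv p) :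
    HasPartials (fun x => F (h x)) (F' * hu) (F' * hv) p :=
  (hF.comp_hasFDerivAt p H).hasPartials_of_eq (by simp) (by simp)

theorem HasPartials.clm {W' : Type*} [NormedAddCommGroup W'] [NormedSpace ℝ W']
    (L : W →L[ℝ] W') {h : ℝ × ℝ → W} {hu hv : W} {p : ℝ × ℝ} (H : HasPartials h hu hv p) :
    HasPartials (fun x => L (h x)) (L hu) (L hv) p :=
  (L.hasFDerivAt.comp p H).hasPartials_of_eq (by simp) (by simp)

theorem HasPartials.clm_apply {W' : Type*} [NormedAddCommGroup W'] [NormedSpace ℝ W']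
    {A : ℝ × ℝ → W →L[ℝ] W'} {Au Av : W →L[ℝ] W'} {h : ℝ × ℝ → W} {hu hv : W} {p : ℝ × ℝ}
    (HA : HasPartials A Au Av p) (H : HasPartials h hu hv p) :
    HasPartials (fun x => A x (h x)) (Au (h p) + A p hu) (Av (h p) + A p hv) p :=
  (HasFDerivAt.clm_apply HA H).hasPartials_of_eq (by simp [add_comm]) (by simp [add_comm])

theorem HasPartials.coord {h : ℝ × ℝ → R31} {hu hv : R31} {p : ℝ × ℝ}
    (H : HasPartials h hu hv p) (i : Fin 3) : HasPartials (fun x => h x i) (hu i) (hv i) p :=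
  H.clm (ContinuousLinearMap.proj (R := ℝ) (φ := fun _ : Fin 3 => ℝ) i)

theorem HasPartials.ip {h k : ℝ × ℝ → R31} {hu hv ku kv : R31} {p : ℝ × ℝ}
    (H : HasPartials h hu hv p) (K : HasPartials k ku kv p) :
    HasPartials (fun x => ip (h x) (k x)) (ip hu (k p) + ip (h p) ku)
      (ip hv (k p) + ip (h p) kv) p := by
  unfold Minkowski.ip
  refine ((((H.coord 0).mul (K.coord 0)).add ((H.coord 1).mul (K.coord 1))).sub
    ((H.coord 2).mul (K.coord 2))).congr_partials ?_ ?_ <;> ring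

theorem HasPartials.eq_zero_of_eq_const {h : ℝ × ℝ → W} {hu hv : W} {p : ℝ × ℝ}
    {U : Set (ℝ × ℝ)} (H : HasPartials h hu hv p) (hU : IsOpen U) (hp : p ∈ U) {c : W}
    (e : ∀ x ∈ U, h x = c) : hu = 0 ∧ hv = 0 :=
  H.unique ((hasPartials_const c p).congr_on hU hp e)

theorem exists_eq_const_of_hasPartials_zero {h : ℝ × ℝ → W} {U : Set (ℝ × ℝ)} (hU : IsOpen U)
    (hc : IsPreconnected U) (H : ∀ p ∈ U, HasPartials h 0 0 p) : ∃ c, ∀ p ∈ U, h p = c := by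
  refine hU.exists_is_const_of_fderiv_eq_zero (𝕜 := ℝ) hc
    (fun p hp => (HasFDerivAt.differentiableAt (H p hp)).differentiableWithinAt) ?_
  intro p hp
  rw [HasFDerivAt.fderiv (H p hp)]
  ext <;> simp

theorem hasPartials_of_contDiffOn {h : ℝ × ℝ → W} {U : Set (ℝ × ℝ)} {n : WithTop ℕ∞}
    (hh : ContDiffOn ℝ n h U) (hn : n ≠ 0) (hU : IsOpen U) {p : ℝ × ℝ} (hp : p ∈ U) :
    HasPartials h (pu h p) (pv h p) p :=
  ((hh.differentiableOn hn).differentiableAt (hU.mem_nhds hp)).hasPartials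

theorem contDiffOn_partials {h : ℝ × ℝ → W} {U : Set (ℝ × ℝ)} {n : WithTop ℕ∞}
    (hh : ContDiffOn ℝ (n + 1) h U) (hU : IsOpen U) :
    ContDiffOn ℝ n (pu h) U ∧ ContDiffOn ℝ n (pv h) U := by
  have h1 := ((contDiffOn_succ_iff_fderiv_of_isOpen hU).1 hh)
  have key : ∀ p ∈ U, HasPartials h (fderiv ℝ h p (1, 0)) (fderiv ℝ h p (0, 1)) p := fun p hp =>
    (h1.1.differentiableAt (hU.mem_nhds hp)).hasFDerivAt.hasPartials
  exact ⟨(h1.2.2.clm_apply contDiffOn_const).congr fun p hp => (key p hp).pu_eq,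
    (h1.2.2.clm_apply contDiffOn_const).congr fun p hp => (key p hp).pv_eq⟩

theorem contDiffOn_succ_of_hasPartials {h hu hv : ℝ × ℝ → W} {U : Set (ℝ × ℝ)} {n : ℕ∞}
    (hU : IsOpen U) (H : ∀ p ∈ U, HasPartials h (hu p) (hv p) p)
    (h1 : ContDiffOn ℝ n hu U) (h2 : ContDiffOn ℝ n hv U) :
    ContDiffOn ℝ ((n : WithTop ℕ∞) + 1) h U := by
  rw [contDiffOn_succ_iff_fderiv_of_isOpen hU]
  refine ⟨fun p hp => (HasFDerivAt.differentiableAt (H p hp)).differentiableWithinAt,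
    fun h => absurd h (by simp), ?_⟩
  have : ContDiffOn ℝ n (fun p => (ContinuousLinearMap.fst ℝ ℝ ℝ).smulRight (hu p) +
    (ContinuousLinearMap.snd ℝ ℝ ℝ).smulRight (hv p)) U :=
    (contDiffOn_const.smulRight h1).add (contDiffOn_const.smulRight h2)
  exact this.congr fun p hp => HasFDerivAt.fderiv (H p hp)

theorem pv_pu_eq_pu_pv {h : ℝ × ℝ → W} {U : Set (ℝ × ℝ)}
    (hh : ContDiffOn ℝ 2 h U) (hU : IsOpen U) {p : ℝ × ℝ} (hp : p ∈ U) :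
    pv (pu h) p = pu (pv h) p := by
  have hd : ContDiffOn ℝ 1 (fderiv ℝ h) U :=
    ((contDiffOn_succ_iff_fderiv_of_isOpen (n := 1) hU).1 (by exact_mod_cast hh)).2.2
  have key : ∀ p ∈ U, HasPartials h (fderiv ℝ h p (1, 0)) (fderiv ℝ h p (0, 1)) p := fun p hp =>
    ((hh.differentiableOn (by simp)).differentiableAt (hU.mem_nhds hp)).hasFDerivAt.hasPartials
  have h2 : HasPartials (fderiv ℝ h) _ _ p :=
    ((hd.differentiableOn (by simp)).differentiableAt (hU.mem_nhds hp)).hasFDerivAt.hasPartials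
  have a1 := ((h2.clm_apply (hasPartials_const ((1 : ℝ), (0 : ℝ)) p)).congr_on hU hp
    (h' := pu h) fun x hx => (key x hx).pu_eq).pv_eq
  have a2 := ((h2.clm_apply (hasPartials_const ((0 : ℝ), (1 : ℝ)) p)).congr_on hU hp
    (h' := pv h) fun x hx => (key x hx).pv_eq).pu_eq
  rw [a1, a2]
  have := (hh.contDiffAt (hU.mem_nhds hp)).isSymmSndFDerivAt (by simp)
  simpa using (this (0, 1) (1, 0))

/-- Continuity of both partial derivatives upgrades separate differentiability to joint
differentiability. The integral construction below yields derivatives along coordinate lines only.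
-/
theorem hasPartials_of_slices {h hu hv : ℝ × ℝ → W} {U : Set (ℝ × ℝ)} (hU : IsOpen U)
    (h1 : ∀ p ∈ U, HasDerivAt (fun u => h (u, p.2)) (hu p) p.1)
    (h2 : ∀ p ∈ U, HasDerivAt (fun v => h (p.1, v)) (hv p) p.2)
    (c1 : ContinuousOn hu U) (c2 : ContinuousOn hv U) {p : ℝ × ℝ} (hp : p ∈ U) :
    HasPartials h (hu p) (hv p) p := by
  have hm := hU.mem_nhds hp
  have e1 : Continuous fun w : W => (ContinuousLinearMap.toSpanSingleton ℝ w) :=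
    (ContinuousLinearMap.toSpanSingletonCLE (𝕜 := ℝ) (E := W)).continuous
  have := (hasStrictFDerivAt_uncurry_coprod (𝕜 := ℝ) (u := p) (f := fun x y => h (x, y))
    (f₁ := fun x y => ContinuousLinearMap.toSpanSingleton ℝ (hu (x, y)))
    (f₂ := fun x y => ContinuousLinearMap.toSpanSingleton ℝ (hv (x, y)))
    (Filter.eventually_of_mem hm fun q hq => (h1 q hq).hasFDerivAt)
    (Filter.eventually_of_mem hm fun q hq => (h2 q hq).hasFDerivAt)
    (e1.continuousAt.comp (c1.continuousAt hm))
    (e1.continuousAt.comp (c2.continuousAt hm))).hasFDerivAt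
  exact this.hasPartials_of_eq (by simp [Function.HasUncurry.uncurry])
    (by simp [Function.HasUncurry.uncurry])

end Partials

/-! ### A Frobenius theorem for linear systems in two variables -/

section Frobenius

/-- The nearest point of the interval `[x₀ - r, x₀ + r]`. -/
def clamp (x₀ r x : ℝ) : ℝ := max (x₀ - r) (min (x₀ + r) x)

theorem continuous_clamp (x₀ r : ℝ) : Continuous (clamp x₀ r) := by
  unfold clamp; fun_prop

theorem abs_clamp_sub_le {x₀ r : ℝ} (hr : 0 ≤ r) (x : ℝ) : |clamp x₀ r x - x₀| ≤ r := by
  unfold clamp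
  rw [abs_le]
  constructor
  · linarith [le_max_left (x₀ - r) (min (x₀ + r) x)]
  · have : max (x₀ - r) (min (x₀ + r) x) ≤ x₀ + r := max_le (by linarith) (min_le_left _ _)
    linarith

theorem clamp_eq {x₀ r x : ℝ} (hx : |x - x₀| ≤ r) : clamp x₀ r x = x := by
  rw [abs_le] at hx
  unfold clamp
  rw [min_eq_right (by linarith), max_eq_right (by linarith)]

theorem abs_sub_le_of_mem_uIcc {x₀ r s x : ℝ} (hx : |x - x₀| ≤ r) (hs : s ∈ uIcc x₀ x) :
    |s - x₀| ≤ r := by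
  rw [abs_sub_comm] at hx ⊢
  rcases mem_uIcc.1 hs with h | h
  · rw [abs_le] at *; constructor <;> linarith
  · rw [abs_le] at *; constructor <;> linarith

theorem abs_sub_lt_of_mem_uIcc {x₀ r s x : ℝ} (hx : |x - x₀| < r) (hs : s ∈ uIcc x₀ x) :
    |s - x₀| < r :=
  (abs_sub_le_of_mem_uIcc le_rfl hs).trans_lt hx

variable {V : Type*} [NormedAddCommGroup V] [NormedSpace ℝ V] [CompleteSpace V]

/-- Picard iteration along broken paths: first in `u` on the line `v = v₀`, then in `v`. The map is
a contraction once the radius is small compared with `1 / C`. No compatibility is needed here, since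
only one path to each point is used. -/
theorem exists_iterated_integral_fixedPoint {P Q : ℝ × ℝ → V →L[ℝ] V} (hP : Continuous P)
    (hQ : Continuous Q) {C r : ℝ} (hr : 0 ≤ r) (bP : ∀ p, ‖P p‖ ≤ C)
    (bQ : ∀ p, ‖Q p‖ ≤ C) (hCr : 4 * (r * C) ≤ 1) (u₀ v₀ : ℝ) (Φ₀ : V) :
    ∃ Φ : ℝ × ℝ → V, Continuous Φ ∧ ∀ u v, |u - u₀| ≤ r → |v - v₀| ≤ r →
      Φ (u, v) = Φ₀ + (∫ s in u₀..u, P (s, v₀) (Φ (s, v₀))) +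
        ∫ t in v₀..v, Q (u, t) (Φ (u, t)) := by
  have hC : 0 ≤ C := (norm_nonneg _).trans (bP 0)
  -- Clamping the upper limits leaves the equation unchanged on the square of radius `r` and makes
  -- the operator act on bounded continuous functions on the whole plane.
  let J : (ℝ × ℝ → V) → ℝ × ℝ → V := fun Φ p =>
    (∫ s in u₀..clamp u₀ r p.1, P (s, v₀) (Φ (s, v₀))) +
      ∫ t in v₀..clamp v₀ r p.2, Q (p.1, t) (Φ (p.1, t))
  have Jcont : ∀ Φ : ℝ × ℝ → V, Continuous Φ → Continuous (J Φ) := by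
    intro Φ hΦ
    have c1 := (continuous_clamp u₀ r).comp (continuous_fst (X := ℝ) (Y := ℝ))
    have c2 := (continuous_clamp v₀ r).comp (continuous_snd (X := ℝ) (Y := ℝ))
    refine Continuous.add ?_ ?_
    · exact intervalIntegral.continuous_parametric_intervalIntegral_of_continuous
        (f := fun (_ : ℝ × ℝ) s => P (s, v₀) (Φ (s, v₀)))
        (by unfold Function.uncurry; fun_prop) c1
    · exact intervalIntegral.continuous_parametric_intervalIntegral_of_continuous
        (f := fun (p : ℝ × ℝ) t => Q (p.1, t) (Φ (p.1, t)))
        (by unfold Function.uncurry; fun_prop) c2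
  -- Each of the two integrals is at most `C M r ≤ M / 4`, whence the contraction constant `1 / 2`.
  have Jbound : ∀ (Φ : ℝ × ℝ → V) (M : ℝ), (∀ p, ‖Φ p‖ ≤ M) → ∀ p, ‖J Φ p‖ ≤ 1 / 2 * M := by
    intro Φ M hM p
    have hM0 : 0 ≤ M := (norm_nonneg _).trans (hM 0)
    have h1 : ‖∫ s in u₀..clamp u₀ r p.1, P (s, v₀) (Φ (s, v₀))‖ ≤
        C * M * |clamp u₀ r p.1 - u₀| :=
      intervalIntegral.norm_integral_le_of_norm_le_const fun s _ =>
        (P (s, v₀)).le_of_opNorm_le_of_le (bP _) (hM _)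
    have h2 : ‖∫ t in v₀..clamp v₀ r p.2, Q (p.1, t) (Φ (p.1, t))‖ ≤
        C * M * |clamp v₀ r p.2 - v₀| :=
      intervalIntegral.norm_integral_le_of_norm_le_const fun s _ =>
        (Q (p.1, s)).le_of_opNorm_le_of_le (bQ _) (hM _)
    have hCM : 0 ≤ C * M := mul_nonneg hC hM0
    have h3 := mul_le_mul_of_nonneg_left (abs_clamp_sub_le (x₀ := u₀) hr p.1) hCM
    have h4 := mul_le_mul_of_nonneg_left (abs_clamp_sub_le (x₀ := v₀) hr p.2) hCM
    have h5 := mul_le_mul_of_nonneg_right hCr hM0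
    calc ‖J Φ p‖ ≤ _ := norm_add_le _ _
      _ ≤ 1 / 2 * M := by linarith
  have Jsub : ∀ Φ Ψ : ℝ × ℝ → V, Continuous Φ → Continuous Ψ → ∀ p,
      J (fun q => Φ q - Ψ q) p = J Φ p - J Ψ p := by
    intro Φ Ψ hΦ hΨ p
    simp only [J, map_sub]
    rw [intervalIntegral.integral_sub, intervalIntegral.integral_sub]
    · abel
    all_goals exact Continuous.intervalIntegrable (by fun_prop) _ _
  let T : BoundedContinuousFunction (ℝ × ℝ) V → BoundedContinuousFunction (ℝ × ℝ) V := fun Φ =>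
    BoundedContinuousFunction.ofNormedAddCommGroup (fun p => Φ₀ + J Φ p)
      (continuous_const.add (Jcont Φ Φ.continuous)) (‖Φ₀‖ + 1 / 2 * ‖Φ‖)
      fun p => (norm_add_le _ _).trans
        (add_le_add_right (Jbound Φ ‖Φ‖ (fun q => Φ.norm_coe_le_norm q) p) _)
  have hT : ContractingWith (1 / 2) T := by
    refine ⟨by norm_num, LipschitzWith.of_dist_le_mul fun Φ Ψ => ?_⟩
    rw [BoundedContinuousFunction.dist_le (by positivity)]
    intro p
    have : dist (T Φ p) (T Ψ p) = ‖J (fun q => Φ q - Ψ q) p‖ := by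
      rw [Jsub Φ Ψ Φ.continuous Ψ.continuous, dist_eq_norm]
      simp [T]
    rw [this, dist_eq_norm]
    have := Jbound (fun q => Φ q - Ψ q) ‖Φ - Ψ‖
      (fun q => (Φ - Ψ).norm_coe_le_norm q) p
    simpa using this
  obtain ⟨Φ, hΦ⟩ : ∃ Φ, T Φ = Φ := ⟨_, hT.fixedPoint_isFixedPt⟩
  refine ⟨Φ, Φ.continuous, fun u v hu hv => ?_⟩
  have := DFunLike.congr_fun hΦ (u, v)
  rw [← this]
  simp only [T, J, BoundedContinuousFunction.coe_ofNormedAddCommGroup, clamp_eq hu, clamp_eq hv,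
    add_assoc]

/-- The `v`-equation is read off the integral equation. For the `u`-equation, `Φ` is compared with a
function whose `u`-derivative is `P Φ` by construction. Compatibility turns their difference into a
solution of a homogeneous integral equation, which forces it to vanish on a small square. Thus `Φ`
need not be known to be differentiable in `u` beforehand. -/
theorem hasDerivAt_iterated_integral {P Q Pv R : ℝ × ℝ → V →L[ℝ] V} (hP : Continuous P)
    (hQ : Continuous Q) (hR : Continuous R) {C r u₀ v₀ : ℝ} (hr : 0 < r) (hr1 : r ≤ 1)
    (bQ : ∀ p, ‖Q p‖ ≤ C) (bR : ∀ p, ‖R p‖ ≤ C) (hCr : 4 * (r * C) ≤ 1)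
    (dP : ∀ u v, |u - u₀| < r → |v - v₀| < r → HasDerivAt (fun t => P (u, t)) (Pv (u, v)) v)
    (dQ : ∀ u v, |u - u₀| < r → |v - v₀| < r → HasDerivAt (fun s => Q (s, v)) (R (u, v)) u)
    (compat : ∀ u v, |u - u₀| < r → |v - v₀| < r →
      Pv (u, v) + P (u, v) ∘L Q (u, v) = R (u, v) + Q (u, v) ∘L P (u, v))
    {Φ : ℝ × ℝ → V} {Φ₀ : V} (hΦ : Continuous Φ)
    (eΦ : ∀ u v, |u - u₀| ≤ r → |v - v₀| ≤ r →
      Φ (u, v) = Φ₀ + (∫ s in u₀..u, P (s, v₀) (Φ (s, v₀))) +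
        ∫ t in v₀..v, Q (u, t) (Φ (u, t))) (u v : ℝ) (hu : |u - u₀| < r) (hv : |v - v₀| < r) :
    HasDerivAt (fun s => Φ (s, v)) (P (u, v) (Φ (u, v))) u ∧
      HasDerivAt (fun t => Φ (u, t)) (Q (u, v) (Φ (u, v))) v := by
  have hC : 0 ≤ C := (norm_nonneg _).trans (bQ 0)
  have r0 : ∀ x : ℝ, |x - x| ≤ r := fun x => by simpa using hr.le
  have r0' : ∀ x : ℝ, |x - x| < r := fun x => by simpa using hr
  have nhd : ∀ x₀ x : ℝ, |x - x₀| < r → ∀ᶠ y in 𝓝 x, |y - x₀| < r := fun x₀ x h =>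
    (show Continuous fun y : ℝ => |y - x₀| by fun_prop).continuousAt.eventually_lt
      continuousAt_const h
  have Φv : ∀ u v, |u - u₀| < r → |v - v₀| < r →
      HasDerivAt (fun t => Φ (u, t)) (Q (u, v) (Φ (u, v))) v := by
    intro u v hu hv
    have hc : Continuous fun t => Q (u, t) (Φ (u, t)) := by fun_prop
    have := (hc.integral_hasStrictDerivAt v₀ v).hasDerivAt.const_add
      (Φ₀ + (∫ s in u₀..u, P (s, v₀) (Φ (s, v₀))))
    exact this.congr_of_eventuallyEq ((nhd v₀ v hv).mono fun t ht => eΦ u t hu.le ht.le)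
  -- The candidate obtained from the other order of integration: along `u = u₀` first, then in the
  -- `u`-direction.
  let Θ : ℝ × ℝ → V := fun p => Φ (u₀, p.2) + ∫ s in u₀..p.1, P (s, p.2) (Φ (s, p.2))
  have cΘ : Continuous Θ := by
    refine Continuous.add (by fun_prop) ?_
    exact intervalIntegral.continuous_parametric_intervalIntegral_of_continuous
        (f := fun (p : ℝ × ℝ) s => P (s, p.2) (Φ (s, p.2)))
        (by unfold Function.uncurry; fun_prop) continuous_fst
  have Θu : ∀ u v, HasDerivAt (fun s => Θ (s, v)) (P (u, v) (Φ (u, v))) u := by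
    intro u v
    have hc : Continuous fun s => P (s, v) (Φ (s, v)) := by fun_prop
    exact (hc.integral_hasStrictDerivAt u₀ u).hasDerivAt.const_add (Φ (u₀, v))
  -- By compatibility the `v`-derivative of `P Φ` is `H = R Φ + Q P Φ`. Fubini exchanges its double
  -- integral, and since `Θ_u = P Φ`, the term `Q P Φ` integrates in `u` through the product rule
  -- for `Q Θ`.
  have defect : ∀ u v, |u - u₀| < r → |v - v₀| < r →
      Θ (u, v) - Φ (u, v) = ∫ t in v₀..v, (Q (u, t) (Θ (u, t) - Φ (u, t)) -
        ∫ s in u₀..u, R (s, t) (Θ (s, t) - Φ (s, t))) := by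
    intro u v hu hv
    let H : ℝ × ℝ → V := fun p => R p (Φ p) + Q p (P p (Φ p))
    have cH : Continuous H := by fun_prop
    have e1 : Θ (u, v) = Φ (u₀, v₀) + (∫ t in v₀..v, Q (u₀, t) (Φ (u₀, t))) +
        (∫ s in u₀..u, P (s, v₀) (Φ (s, v₀))) + ∫ s in u₀..u, ∫ t in v₀..v, H (s, t) := by
      have a1 : Φ (u₀, v) = Φ (u₀, v₀) + ∫ t in v₀..v, Q (u₀, t) (Φ (u₀, t)) := by
        rw [eΦ u₀ v (r0 _) hv.le, eΦ u₀ v₀ (r0 _) (r0 _)]; simp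
      have a2 : ∀ s ∈ uIcc u₀ u, P (s, v) (Φ (s, v)) =
          P (s, v₀) (Φ (s, v₀)) + ∫ t in v₀..v, H (s, t) := by
        intro s hs
        have hs' := abs_sub_lt_of_mem_uIcc hu hs
        have := intervalIntegral.integral_eq_sub_of_hasDerivAt (a := v₀) (b := v)
          (f := fun t => P (s, t) (Φ (s, t))) (f' := fun t => H (s, t)) ?_
          (Continuous.intervalIntegrable (by fun_prop) _ _)
        · rw [this]; abel
        · intro t ht
          have ht' := abs_sub_lt_of_mem_uIcc hv ht
          have d := (dP s t hs' ht').clm_apply (Φv s t hs' ht')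
          convert d using 1
          have := congrArg (fun L : V →L[ℝ] V => L (Φ (s, t))) (compat s t hs' ht')
          simpa using this.symm
      simp only [Θ]
      rw [a1, intervalIntegral.integral_congr a2, intervalIntegral.integral_add]
      · abel
      · exact Continuous.intervalIntegrable (by fun_prop) _ _
      · refine Continuous.intervalIntegrable ?_ _ _
        exact intervalIntegral.continuous_parametric_intervalIntegral_of_continuous'
          (f := fun s t => H (s, t)) (by unfold Function.uncurry; exact cH) _ _
    have e2 : Φ (u, v) = Φ (u₀, v₀) + (∫ s in u₀..u, P (s, v₀) (Φ (s, v₀))) +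
        ∫ t in v₀..v, Q (u, t) (Φ (u, t)) := by
      rw [eΦ u v hu.le hv.le, eΦ u₀ v₀ (r0 _) (r0 _)]; simp
    have e3 : ∫ s in u₀..u, ∫ t in v₀..v, H (s, t) = ∫ t in v₀..v, ∫ s in u₀..u, H (s, t) := by
      refine MeasureTheory.intervalIntegral_intervalIntegral_swap (F := fun s t => H (s, t)) ?_
      have : Function.uncurry (fun s t => H (s, t)) = H := rfl
      rw [this]
      exact (cH.continuousOn.integrableOn_compact (isCompact_uIcc.prod isCompact_uIcc)).mono_set
        (prod_mono uIoc_subset_uIcc uIoc_subset_uIcc)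
    have e4 : ∀ t ∈ uIcc v₀ v, Q (u₀, t) (Φ (u₀, t)) + (∫ s in u₀..u, H (s, t)) -
        Q (u, t) (Φ (u, t)) = Q (u, t) (Θ (u, t) - Φ (u, t)) -
        ∫ s in u₀..u, R (s, t) (Θ (s, t) - Φ (s, t)) := by
      intro t ht
      have ht' := abs_sub_lt_of_mem_uIcc hv ht
      have := intervalIntegral.integral_eq_sub_of_hasDerivAt (a := u₀) (b := u)
          (f := fun s => Q (s, t) (Θ (s, t)))
          (f' := fun s => R (s, t) (Θ (s, t)) + Q (s, t) (P (s, t) (Φ (s, t)))) ?_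
          (Continuous.intervalIntegrable (by fun_prop) _ _)
      · have hΘ : Θ (u₀, t) = Φ (u₀, t) := by simp [Θ]
        rw [hΘ] at this
        have h2 : ∫ s in u₀..u, R (s, t) (Θ (s, t) - Φ (s, t)) =
            (∫ s in u₀..u, R (s, t) (Θ (s, t)) + Q (s, t) (P (s, t) (Φ (s, t)))) -
            ∫ s in u₀..u, H (s, t) := by
          rw [← intervalIntegral.integral_sub]
          · refine intervalIntegral.integral_congr fun s _ => ?_
            simp only [H, map_sub]; abel
          all_goals exact Continuous.intervalIntegrable (by fun_prop) _ _
        rw [h2, this, map_sub]; abel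
      · intro s hs
        exact (dQ s t (abs_sub_lt_of_mem_uIcc hu hs) ht').clm_apply (Θu s t)
    have cI : Continuous fun t => ∫ s in u₀..u, H (s, t) :=
      intervalIntegral.continuous_parametric_intervalIntegral_of_continuous'
          (f := fun t s => H (s, t)) (by unfold Function.uncurry; fun_prop) _ _
    rw [← intervalIntegral.integral_congr e4, intervalIntegral.integral_sub,
      intervalIntegral.integral_add, e1, e2, e3]
    · abel
    all_goals exact Continuous.intervalIntegrable (by fun_prop) _ _
  -- Let `M` be the maximum of the defect on the closed square. The integral equation gives the
  -- bound `r (C M + C M) ≤ M / 2` inside (using `r ≤ 1` for the inner integral), and by density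
  -- also at the maximum point, so `M = 0`.
  obtain ⟨q, hq, hmax⟩ := (isCompact_closedBall (u₀, v₀) r).exists_isMaxOn
    ⟨(u₀, v₀), Metric.mem_closedBall_self hr.le⟩
    (f := fun p => ‖Θ p - Φ p‖) (by fun_prop)
  have memc : ∀ u v, |u - u₀| ≤ r → |v - v₀| ≤ r → (u, v) ∈ Metric.closedBall (u₀, v₀) r := by
    intro u v hu hv
    rw [Metric.mem_closedBall, Prod.dist_eq, Real.dist_eq, Real.dist_eq]
    exact max_le hu hv
  set M := ‖Θ q - Φ q‖ with hM
  have hM0 : 0 ≤ M := norm_nonneg _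
  have half : ∀ u v, |u - u₀| < r → |v - v₀| < r → ‖Θ (u, v) - Φ (u, v)‖ ≤ M / 2 := by
    intro u v hu hv
    rw [defect u v hu hv]
    have hCM : 0 ≤ C * M := mul_nonneg hC hM0
    refine (intervalIntegral.norm_integral_le_of_norm_le_const (C := C * M + C * M) ?_).trans ?_
    · intro t ht
      have ht' := abs_sub_le_of_mem_uIcc hv.le (uIoc_subset_uIcc ht)
      refine (norm_sub_le _ _).trans (add_le_add ?_ ?_)
      · exact (Q (u, t)).le_of_opNorm_le_of_le (bQ _) (hmax (memc u t hu.le ht'))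
      · refine (intervalIntegral.norm_integral_le_of_norm_le_const (C := C * M) ?_).trans ?_
        · intro s hs
          exact (R (s, t)).le_of_opNorm_le_of_le (bR _)
            (hmax (memc s t (abs_sub_le_of_mem_uIcc hu.le (uIoc_subset_uIcc hs)) ht'))
        · exact mul_le_of_le_one_right hCM (hu.le.trans hr1)
    · have h1 := mul_le_mul_of_nonneg_left hv.le (add_nonneg hCM hCM)
      have h2 := mul_le_mul_of_nonneg_right hCr hM0
      linarith
  have hM' : M ≤ M / 2 := by
    have : Metric.closedBall (u₀, v₀) r ⊆ {p | ‖Θ p - Φ p‖ ≤ M / 2} := by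
      rw [← closure_ball _ hr.ne']
      refine closure_minimal ?_ (isClosed_le (by fun_prop) (by fun_prop))
      rintro ⟨u, v⟩ h
      rw [Metric.mem_ball, Prod.dist_eq, Real.dist_eq, Real.dist_eq, max_lt_iff] at h
      exact half u v h.1 h.2
    exact this hq
  have zero : ∀ u v, |u - u₀| < r → |v - v₀| < r → Φ (u, v) = Θ (u, v) := by
    intro u v hu hv
    have := half u v hu hv
    have : ‖Θ (u, v) - Φ (u, v)‖ ≤ 0 := by linarith
    exact (sub_eq_zero.1 (norm_le_zero_iff.1 this)).symm
  exact ⟨(Θu u v).congr_of_eventuallyEq ((nhd u₀ u hu).mono fun s hs => zero s v hs hv),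
    Φv u v hu hv⟩

/-- Local solvability of the completely integrable linear system `Φ_u = P Φ`, `Φ_v = Q Φ`. -/
theorem exists_solution_of_compatible_linear_system {U : Set (ℝ × ℝ)} (hU : IsOpen U)
    {P Q : ℝ × ℝ → V →L[ℝ] V} (hP : ContDiffOn ℝ 1 P U) (hQ : ContDiffOn ℝ 1 Q U)
    (compat : ∀ p ∈ U, pv P p + P p ∘L Q p = pu Q p + Q p ∘L P p)
    {p₀ : ℝ × ℝ} (hp₀ : p₀ ∈ U) (Φ₀ : V) :
    ∃ r > 0, Metric.ball p₀ r ⊆ U ∧ ∃ Φ : ℝ × ℝ → V, Φ p₀ = Φ₀ ∧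
      ∀ p ∈ Metric.ball p₀ r, HasPartials Φ (P p (Φ p)) (Q p (Φ p)) p := by
  have cP := hP.continuousOn
  have cQ := hQ.continuousOn
  have cR := (contDiffOn_partials (n := 0) (by simpa using hQ) hU).1.continuousOn
  have nU := hU.mem_nhds hp₀
  -- The summand `1` makes the bounds strict near `p₀` and gives `C ≥ 1`, so that `4 r C ≤ 1` also
  -- forces `r ≤ 1`.
  set C : ℝ := ‖P p₀‖ + ‖Q p₀‖ + ‖pu Q p₀‖ + 1 with hC
  have C1 : 1 ≤ C := by
    have := norm_nonneg (P p₀); have := norm_nonneg (Q p₀); have := norm_nonneg (pu Q p₀)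
    linarith
  have small : ∀ᶠ p in 𝓝 p₀, p ∈ U ∧ ‖P p‖ < C ∧ ‖Q p‖ < C ∧ ‖pu Q p‖ < C := by
    have := norm_nonneg (P p₀); have := norm_nonneg (Q p₀); have := norm_nonneg (pu Q p₀)
    refine (hU.eventually_mem hp₀).and (((cP.continuousAt nU).norm.eventually_lt
      continuousAt_const (by linarith)).and (((cQ.continuousAt nU).norm.eventually_lt
      continuousAt_const (by linarith)).and ((cR.continuousAt nU).norm.eventually_lt
      continuousAt_const (by linarith))))
  obtain ⟨ε, hε, hball⟩ := Metric.nhds_basis_closedBall.eventually_iff.1 small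
  set r : ℝ := min ε (1 / (4 * C)) with hr
  have hr0 : 0 < r := lt_min hε (by positivity)
  have hrC : 4 * (r * C) ≤ 1 := by
    have : r * (4 * C) ≤ 1 := by
      rw [← le_div_iff₀ (by positivity)]; exact min_le_right _ _
    linarith
  have hr1 : r ≤ 1 := by nlinarith
  obtain ⟨u₀, v₀⟩ := p₀
  -- Precomposing with this retraction onto a small square extends the coefficients to bounded
  -- continuous functions on the plane, without changing them on the square.
  let κ : ℝ × ℝ → ℝ × ℝ := fun p => (clamp u₀ r p.1, clamp v₀ r p.2)
  have cκ : Continuous κ := by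
    have := continuous_clamp u₀ r; have := continuous_clamp v₀ r
    fun_prop
  have mκ : ∀ p, κ p ∈ Metric.closedBall (u₀, v₀) ε := by
    intro p
    rw [Metric.mem_closedBall, Prod.dist_eq, Real.dist_eq, Real.dist_eq]
    exact (max_le (abs_clamp_sub_le hr0.le _) (abs_clamp_sub_le hr0.le _)).trans (min_le_left _ _)
  have κe : ∀ u v, |u - u₀| < r → |v - v₀| < r → κ (u, v) = (u, v) := fun u v hu hv => by
    simp only [κ, clamp_eq hu.le, clamp_eq hv.le]
  have nhd : ∀ x₀ x : ℝ, |x - x₀| < r → ∀ᶠ y in 𝓝 x, |y - x₀| < r := fun x₀ x h =>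
    (show Continuous fun y : ℝ => |y - x₀| by fun_prop).continuousAt.eventually_lt
      continuousAt_const h
  have mU : ∀ u v, |u - u₀| < r → |v - v₀| < r → (u, v) ∈ U := fun u v hu hv =>
    κe u v hu hv ▸ (hball (mκ (u, v))).1
  have cPκ : Continuous (P ∘ κ) := cP.comp_continuous cκ fun p => (hball (mκ p)).1
  have cQκ : Continuous (Q ∘ κ) := cQ.comp_continuous cκ fun p => (hball (mκ p)).1
  have cRκ : Continuous (pu Q ∘ κ) := cR.comp_continuous cκ fun p => (hball (mκ p)).1
  obtain ⟨Φ, cΦ, eΦ⟩ := exists_iterated_integral_fixedPoint cPκ cQκ hr0.le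
    (fun p => (hball (mκ p)).2.1.le) (fun p => (hball (mκ p)).2.2.1.le) hrC u₀ v₀ Φ₀
  have key := hasDerivAt_iterated_integral (Pv := pv P) cPκ cQκ cRκ hr0 hr1
    (fun p => (hball (mκ p)).2.2.1.le) (fun p => (hball (mκ p)).2.2.2.le) hrC
    (fun u v hu hv => ((hasPartials_of_contDiffOn hP (by simp) hU
      (mU u v hu hv)).hasDerivAt_snd).congr_of_eventuallyEq
        ((nhd v₀ v hv).mono fun t ht => by simp [κe u t hu ht]))
    (fun u v hu hv => by
      simp only [Function.comp_apply, κe u v hu hv]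
      exact ((hasPartials_of_contDiffOn hQ (by simp) hU
        (mU u v hu hv)).hasDerivAt_fst).congr_of_eventuallyEq
          ((nhd u₀ u hu).mono fun s hs => by simp [κe s v hs hv]))
    (fun u v hu hv => by simpa [κe u v hu hv] using compat _ (mU u v hu hv)) cΦ eΦ
  have mb : ∀ p ∈ Metric.ball (u₀, v₀) r, |p.1 - u₀| < r ∧ |p.2 - v₀| < r := by
    intro p hp
    rwa [Metric.mem_ball, Prod.dist_eq, Real.dist_eq, Real.dist_eq, max_lt_iff] at hp
  have sub : Metric.ball (u₀, v₀) r ⊆ U := fun p hp => mU p.1 p.2 (mb p hp).1 (mb p hp).2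
  refine ⟨r, hr0, sub, Φ, ?_, fun p hp => ?_⟩
  · rw [eΦ u₀ v₀ (by simpa using hr0.le) (by simpa using hr0.le)]; simp
  · refine hasPartials_of_slices (hu := fun p => P p (Φ p)) (hv := fun p => Q p (Φ p))
      Metric.isOpen_ball (fun p hp => ?_) (fun p hp => ?_)
      ((cP.mono sub).clm_apply cΦ.continuousOn) ((cQ.mono sub).clm_apply cΦ.continuousOn) hp
    · have := (key p.1 p.2 (mb p hp).1 (mb p hp).2).1
      simpa only [Function.comp_apply, κe p.1 p.2 (mb p hp).1 (mb p hp).2] using this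
    · have := (key p.1 p.2 (mb p hp).1 (mb p hp).2).2
      simpa only [Function.comp_apply, κe p.1 p.2 (mb p hp).1 (mb p hp).2] using this

end Frobenius

/-! ### Lorentzian orthonormal frames, moving frames and motions -/

section Frames

theorem ip_comm (x y : R31) : ip x y = ip y x := by unfold ip; ring

theorem ip_add_left (x y w : R31) : ip (x + y) w = ip x w + ip y w := by
  simp only [ip, Pi.add_apply]; ring

theorem ip_add_right (w x y : R31) : ip w (x + y) = ip w x + ip w y := by
  simp only [ip, Pi.add_apply]; ring

theorem ip_sub_right (w x y : R31) : ip w (x - y) = ip w x - ip w y := by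
  simp only [ip, Pi.sub_apply]; ring

theorem ip_smul_left (c : ℝ) (x w : R31) : ip (c • x) w = c * ip x w := by
  simp only [ip, Pi.smul_apply, smul_eq_mul]; ring

theorem ip_smul_right (c : ℝ) (w x : R31) : ip w (c • x) = c * ip w x := by
  simp only [ip, Pi.smul_apply, smul_eq_mul]; ring

theorem cross_eq (x y : R31) : cross x y =
    ![x 1 * y 2 - x 2 * y 1, x 2 * y 0 - x 0 * y 2, -(x 0 * y 1 - x 1 * y 0)] := by
  simp [cross, cross_apply]

theorem cross_zero (x y : R31) : cross x y 0 = x 1 * y 2 - x 2 * y 1 := by simp [cross_eq]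

theorem cross_one (x y : R31) : cross x y 1 = x 2 * y 0 - x 0 * y 2 := by simp [cross_eq]

theorem cross_two (x y : R31) : cross x y 2 = -(x 0 * y 1 - x 1 * y 0) := by simp [cross_eq]

theorem cross_smul_smul (c d : ℝ) (x y : R31) : cross (c • x) (d • y) = (c * d) • cross x y := by
  ext i
  fin_cases i <;> simp [cross_eq] <;> ring

theorem ip_cross_left_self (x y : R31) : ip (cross x y) x = 0 := by
  simp only [ip, cross_zero, cross_one, cross_two]; ring

theorem ip_cross_right_self (x y : R31) : ip (cross x y) y = 0 := by
  simp only [ip, cross_zero, cross_one, cross_two]; ring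

theorem ip_cross_cross (x y : R31) :
    ip (cross x y) (cross x y) = ip x y ^ 2 - ip x x * ip y y := by
  simp only [ip, cross_zero, cross_one, cross_two]; ring

/-- The matrix with columns `X`, `Y`, `l`. -/
def frameMatrix (X Y l : R31) : Matrix (Fin 3) (Fin 3) ℝ :=
  !![X 0, Y 0, l 0; X 1, Y 1, l 1; X 2, Y 2, l 2]

/-- The matrix whose rows are the metric duals of `-X`, `Y`, `l`. -/
def coframeMatrix (X Y l : R31) : Matrix (Fin 3) (Fin 3) ℝ :=
  !![-X 0, -X 1, X 2; Y 0, Y 1, -Y 2; l 0, l 1, -l 2]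

theorem coframeMatrix_mul_frameMatrix (X Y l X' Y' l' : R31) :
    coframeMatrix X Y l * frameMatrix X' Y' l' =
      !![-ip X X', -ip X Y', -ip X l'; ip Y X', ip Y Y', ip Y l'; ip l X', ip l Y', ip l l'] := by
  unfold coframeMatrix frameMatrix ip
  ext i j
  fin_cases i <;> fin_cases j <;>
    simp [Matrix.mul_apply, Fin.sum_univ_three] <;> ring

theorem frameMatrix_mul_coframeMatrix_mulVec (X Y l X' Y' l' x : R31) :
    (frameMatrix X' Y' l' * coframeMatrix X Y l).mulVec x =
      (-ip X x) • X' + ip Y x • Y' + ip l x • l' := by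
  unfold coframeMatrix frameMatrix ip
  ext i
  fin_cases i <;>
    simp [Matrix.mulVec, dotProduct, Matrix.mul_apply, Fin.sum_univ_three] <;> ring

theorem det_frameMatrix (X Y l : R31) : (frameMatrix X Y l).det = ip (cross X Y) l := by
  simp only [frameMatrix, Matrix.det_fin_three, ip, cross_zero, cross_one, cross_two]
  simp; ring

/-- `X, Y, l` is a positively oriented orthonormal frame with `X` time-like. -/
structure IsFrame (X Y l : R31) : Prop where
  XX : ip X X = -1
  YY : ip Y Y = 1
  XY : ip X Y = 0
  cross_eq : cross X Y = l

namespace IsFrame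

variable {X Y l X' Y' l' : R31}

theorem lX (h : IsFrame X Y l) : ip l X = 0 := h.cross_eq ▸ ip_cross_left_self X Y

theorem lY (h : IsFrame X Y l) : ip l Y = 0 := h.cross_eq ▸ ip_cross_right_self X Y

theorem ll (h : IsFrame X Y l) : ip l l = 1 := by
  have := ip_cross_cross X Y
  rw [h.cross_eq, h.XX, h.YY, h.XY] at this
  linarith

theorem YX (h : IsFrame X Y l) : ip Y X = 0 := ip_comm Y X ▸ h.XY

theorem Xl (h : IsFrame X Y l) : ip X l = 0 := ip_comm X l ▸ h.lX

theorem Yl (h : IsFrame X Y l) : ip Y l = 0 := ip_comm Y l ▸ h.lY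

theorem coframe_mul (h : IsFrame X Y l) : coframeMatrix X Y l * frameMatrix X Y l = 1 := by
  rw [coframeMatrix_mul_frameMatrix, h.XX, h.YY, h.XY, h.lX, h.lY, h.ll, h.YX, h.Xl, h.Yl]
  ext i j; fin_cases i <;> fin_cases j <;> simp

theorem expand (h : IsFrame X Y l) (w : R31) :
    w = (-ip X w) • X + ip Y w • Y + ip l w • l := by
  rw [← frameMatrix_mul_coframeMatrix_mulVec, mul_eq_one_comm.1 h.coframe_mul, Matrix.one_mulVec]

theorem det_frame (h : IsFrame X Y l) : (frameMatrix X Y l).det = 1 := by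
  rw [det_frameMatrix, h.cross_eq, h.ll]

theorem det_coframe (h : IsFrame X Y l) : (coframeMatrix X Y l).det = 1 := by
  have := congrArg Matrix.det h.coframe_mul
  rwa [Matrix.det_mul, h.det_frame, mul_one, Matrix.det_one] at this

/-- Completeness makes the coframe a one-sided inverse of the frame matrix. For square matrices it
is then two-sided, which is orthonormality. The determinant condition fixes the sign of the normal.
Completeness is the form in which orthonormality propagates along the structure equations. -/
theorem of_completeness
    (h : ∀ x, (-ip X x) • X + ip Y x • Y + ip l x • l = x) (hd : ip (cross X Y) l = 1) :
    IsFrame X Y l := by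
  have h1 : frameMatrix X Y l * coframeMatrix X Y l = 1 := by
    refine Matrix.ext_of_mulVec_single fun i => ?_
    rw [frameMatrix_mul_coframeMatrix_mulVec, h, Matrix.one_mulVec]
  have h2 := mul_eq_one_comm.1 h1
  rw [coframeMatrix_mul_frameMatrix] at h2
  have e := fun i j => congrFun (congrFun h2 i) j
  have e00 := e 0 0
  have e01 := e 0 1
  have e11 := e 1 1
  simp at e00 e01 e11
  refine ⟨by linarith, e11, e01, ?_⟩
  have := h (cross X Y)
  rw [ip_comm X, ip_comm Y, ip_comm l, ip_cross_left_self, ip_cross_right_self, hd] at this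
  simpa using this.symm

theorem ip_expansion (h : IsFrame X' Y' l') (x₁ x₂ x₃ y₁ y₂ y₃ : ℝ) :
    ip (x₁ • X' + x₂ • Y' + x₃ • l') (y₁ • X' + y₂ • Y' + y₃ • l') =
      -(x₁ * y₁) + x₂ * y₂ + x₃ * y₃ := by
  simp only [ip_add_left, ip_add_right, ip_smul_left, ip_smul_right, h.XX, h.YY, h.XY, h.lX, h.lY,
    h.ll, h.YX, h.Xl, h.Yl]
  ring

theorem isometry (h : IsFrame X Y l) (h' : IsFrame X' Y' l') (x y : R31) :
    ip ((-ip X x) • X' + ip Y x • Y' + ip l x • l')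
      ((-ip X y) • X' + ip Y y • Y' + ip l y • l') = ip x y := by
  rw [h'.ip_expansion, ← h.ip_expansion, ← h.expand, ← h.expand]

end IsFrame

/-- A surface `z` with `z_u = p X`, `z_v = q Y`, together with the orthonormal frame `X, Y, l` and
its structure equations. -/
structure FrameField (U : Set (ℝ × ℝ)) (p q α β γ δ : ℝ × ℝ → ℝ) (z X Y l : ℝ × ℝ → R31) :
    Prop where
  frame : ∀ x ∈ U, IsFrame (X x) (Y x) (l x)
  dz : ∀ x ∈ U, HasPartials z (p x • X x) (q x • Y x) x
  dX : ∀ x ∈ U, HasPartials X (α x • Y x - β x • l x) (γ x • Y x) x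
  dY : ∀ x ∈ U, HasPartials Y (α x • X x) (γ x • X x + δ x • l x) x
  dl : ∀ x ∈ U, HasPartials l (-(β x • X x)) (-(δ x • Y x)) x

/-- Two frames with the same structure equations differ by a constant linear map. -/
theorem frame_transport_constant {U : Set (ℝ × ℝ)} {α β γ δ : ℝ × ℝ → ℝ}
    {X Y l X' Y' l' : ℝ × ℝ → R31}
    (dX : ∀ x ∈ U, HasPartials X (α x • Y x - β x • l x) (γ x • Y x) x)
    (dY : ∀ x ∈ U, HasPartials Y (α x • X x) (γ x • X x + δ x • l x) x)
    (dl : ∀ x ∈ U, HasPartials l (-(β x • X x)) (-(δ x • Y x)) x)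
    (dX' : ∀ x ∈ U, HasPartials X' (α x • Y' x - β x • l' x) (γ x • Y' x) x)
    (dY' : ∀ x ∈ U, HasPartials Y' (α x • X' x) (γ x • X' x + δ x • l' x) x)
    (dl' : ∀ x ∈ U, HasPartials l' (-(β x • X' x)) (-(δ x • Y' x)) x) (y : R31) :
    ∀ x ∈ U, HasPartials
      (fun x => (-ip (X x) y) • X' x + ip (Y x) y • Y' x + ip (l x) y • l' x) 0 0 x := by
  intro x hx
  have k := hasPartials_const y x
  -- The coefficient matrices are skew with respect to the metric `diag(-1, 1, 1)`, so all terms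
  -- cancel. Neither frame has to be orthonormal.
  refine (((((dX x hx).ip k).neg.smul (dX' x hx)).add
    (((dY x hx).ip k).smul (dY' x hx))).add
    (((dl x hx).ip k).smul (dl' x hx))).congr_partials ?_ ?_ <;>
  · ext i
    simp [ip]; ring

/-- The linear map `A` taking one frame to the other does not depend on the point. Hence `w - A z`
has zero derivative, and its constant value is the translation part. -/
theorem FrameField.exists_motion {U : Set (ℝ × ℝ)} (hU : IsOpen U) (hc : IsConnected U)
    {p q α β γ δ : ℝ × ℝ → ℝ} {z X Y l w X' Y' l' : ℝ × ℝ → R31}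
    (h : FrameField U p q α β γ δ z X Y l) (h' : FrameField U p q α β γ δ w X' Y' l') :
    ∃ T : R31 → R31, IsMotion T ∧ ∀ x ∈ U, w x = T (z x) := by
  obtain ⟨x₁, hx₁⟩ := hc.nonempty
  set A := frameMatrix (X' x₁) (Y' x₁) (l' x₁) * coframeMatrix (X x₁) (Y x₁) (l x₁) with hA
  have Aconst : ∀ y, ∀ x ∈ U, A.mulVec y =
      (-ip (X x) y) • X' x + ip (Y x) y • Y' x + ip (l x) y • l' x := by
    intro y
    obtain ⟨c, hc⟩ := exists_eq_const_of_hasPartials_zero hU hc.isPreconnected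
      (frame_transport_constant h.dX h.dY h.dl h'.dX h'.dY h'.dl y)
    intro x hx
    rw [hA, frameMatrix_mul_coframeMatrix_mulVec]
    exact (hc x₁ hx₁).trans (hc x hx).symm
  have AX : ∀ x ∈ U, A.mulVec (X x) = X' x := fun x hx => by
    rw [Aconst _ x hx, (h.frame x hx).XX, (h.frame x hx).YX, (h.frame x hx).lX]; simp
  have AY : ∀ x ∈ U, A.mulVec (Y x) = Y' x := fun x hx => by
    rw [Aconst _ x hx, (h.frame x hx).XY, (h.frame x hx).YY, (h.frame x hx).lY]; simp
  obtain ⟨b, hb⟩ := exists_eq_const_of_hasPartials_zero hU hc.isPreconnected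
    (h := fun x => w x - A.mulVec (z x)) (by
      intro x hx
      have := (h.dz x hx).clm A.mulVecLin.toContinuousLinearMap
      refine ((h'.dz x hx).sub this).congr_partials ?_ ?_ <;>
        simp [AX x hx, AY x hx])
  refine ⟨fun x => A.mulVec x + b, ⟨A, b, ?_, fun x y => ?_, fun x => rfl⟩, fun x hx => ?_⟩
  · rw [hA, Matrix.det_mul, (h'.frame x₁ hx₁).det_frame, (h.frame x₁ hx₁).det_coframe, one_mul]
  · rw [Aconst x x₁ hx₁, Aconst y x₁ hx₁]
    exact (h.frame x₁ hx₁).isometry (h'.frame x₁ hx₁) x y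
  · rw [← hb x hx]; simp

end Frames

/-! ### Structure equations of a surface in principal parameters and the Codazzi equations -/

section Codazzi

theorem contDiffOn_ip {n : WithTop ℕ∞} {U : Set (ℝ × ℝ)} {x y : ℝ × ℝ → R31}
    (hx : ContDiffOn ℝ n x U) (hy : ContDiffOn ℝ n y U) :
    ContDiffOn ℝ n (fun p => ip (x p) (y p)) U := by
  rw [contDiffOn_pi] at hx hy
  exact (((hx 0).mul (hy 0)).add ((hx 1).mul (hy 1))).sub ((hx 2).mul (hy 2))

theorem contDiffOn_cross {n : WithTop ℕ∞} {U : Set (ℝ × ℝ)} {x y : ℝ × ℝ → R31}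
    (hx : ContDiffOn ℝ n x U) (hy : ContDiffOn ℝ n y U) :
    ContDiffOn ℝ n (fun p => cross (x p) (y p)) U := by
  rw [contDiffOn_pi] at hx hy
  rw [contDiffOn_pi]
  intro i
  fin_cases i
  · exact (((hx 1).mul (hy 2)).sub ((hx 2).mul (hy 1))).congr fun p _ => cross_zero _ _
  · exact (((hx 2).mul (hy 0)).sub ((hx 0).mul (hy 2))).congr fun p _ => cross_one _ _
  · exact (((hx 0).mul (hy 1)).sub ((hx 1).mul (hy 0))).neg.congr fun p _ => cross_two _ _

/-- The derivative of an orthonormal frame is skew-adjoint, hence determined by the components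
`α, β, γ, δ` of a principal frame. -/
theorem hasPartials_frame {U : Set (ℝ × ℝ)} (hU : IsOpen U) {X Y l : ℝ × ℝ → R31}
    (hF : ∀ x ∈ U, IsFrame (X x) (Y x) (l x)) {x : ℝ × ℝ} (hx : x ∈ U)
    {Xu Xv Yu Yv lu lv : R31} (hX : HasPartials X Xu Xv x) (hY : HasPartials Y Yu Yv x)
    (hl : HasPartials l lu lv x) {α β γ δ : ℝ}
    (h1 : ip Yu (X x) = -α) (h2 : ip (l x) Xu = -β) (h3 : ip (l x) Yu = 0)
    (h4 : ip Xv (Y x) = γ) (h5 : ip (l x) Xv = 0) (h6 : ip (l x) Yv = δ) :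
    HasPartials X (α • Y x - β • l x) (γ • Y x) x ∧
      HasPartials Y (α • X x) (γ • X x + δ • l x) x ∧
      HasPartials l (-(β • X x)) (-(δ • Y x)) x := by
  have eXX := (hX.ip hX).eq_zero_of_eq_const hU hx fun y hy => (hF y hy).XX
  have eXY := (hX.ip hY).eq_zero_of_eq_const hU hx fun y hy => (hF y hy).XY
  have eYY := (hY.ip hY).eq_zero_of_eq_const hU hx fun y hy => (hF y hy).YY
  have elX := (hl.ip hX).eq_zero_of_eq_const hU hx fun y hy => (hF y hy).lX
  have elY := (hl.ip hY).eq_zero_of_eq_const hU hx fun y hy => (hF y hy).lY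
  have ell := (hl.ip hl).eq_zero_of_eq_const hU hx fun y hy => (hF y hy).ll
  rw [ip_comm Xu, ip_comm Xv] at eXX eXY
  rw [ip_comm (X x) Yu, ip_comm (X x) Yv] at eXY
  rw [ip_comm Yu, ip_comm Yv] at eYY
  rw [ip_comm lu, ip_comm lv] at elX elY ell
  rw [ip_comm Xv] at h4
  obtain ⟨eXX1, eXX2⟩ := eXX
  obtain ⟨eXY1, eXY2⟩ := eXY
  obtain ⟨eYY1, eYY2⟩ := eYY
  obtain ⟨elX1, elX2⟩ := elX
  obtain ⟨elY1, elY2⟩ := elY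
  obtain ⟨ell1, ell2⟩ := ell
  have ex := (hF x hx).expand
  refine ⟨hX.congr_partials ?_ ?_, hY.congr_partials ?_ ?_, hl.congr_partials ?_ ?_⟩
  · rw [ex Xu, h2, show ip (X x) Xu = 0 by linarith, show ip (Y x) Xu = α by linarith]
    module
  · rw [ex Xv, h5, show ip (X x) Xv = 0 by linarith, h4]
    module
  · rw [ex Yu, h3, ip_comm (X x), h1, show ip (Y x) Yu = 0 by linarith]
    module
  · rw [ex Yv, h6, ip_comm (X x), show ip Yv (X x) = -γ by linarith,
      show ip (Y x) Yv = 0 by linarith]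
    module
  · rw [ex lu, show ip (X x) lu = β by linarith, show ip (Y x) lu = 0 by linarith,
      show ip (l x) lu = 0 by linarith]
    module
  · rw [ex lv, show ip (X x) lv = 0 by linarith, show ip (Y x) lv = -δ by linarith,
      show ip (l x) lv = 0 by linarith]
    module

theorem contDiffOn_of_sq_eq {n : WithTop ℕ∞} {U : Set (ℝ × ℝ)} {h p : ℝ × ℝ → ℝ}
    (hh : ContDiffOn ℝ n h U) (hp : ∀ x ∈ U, 0 < p x) (e : ∀ x ∈ U, h x = p x ^ 2) :
    ContDiffOn ℝ n p U := by
  refine (hh.sqrt fun x hx => ?_).congr fun x hx => ?_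
  · rw [e x hx]; exact (pow_pos (hp x hx) 2).ne'
  · rw [e x hx, Real.sqrt_sq (hp x hx).le]

/-- The normalized principal frame of a surface with `E = -p²`, `G = q²`. -/
theorem IsPrincipalTimelike.frameField {U : Set (ℝ × ℝ)} (hU : IsOpen U) {z : ℝ × ℝ → R31}
    (hz : IsPrincipalTimelike U z) {p q : ℝ × ℝ → ℝ} (hp : ∀ x ∈ U, 0 < p x)
    (hq : ∀ x ∈ U, 0 < q x) (hE : ∀ x ∈ U, coefE z x = -p x ^ 2)
    (hG : ∀ x ∈ U, coefG z x = q x ^ 2) :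
    (ContDiffOn ℝ 2 p U ∧ ContDiffOn ℝ 2 q U) ∧
    (ContDiffOn ℝ 2 (fun x => (p x)⁻¹ • pu z x) U ∧
      ContDiffOn ℝ 2 (fun x => (q x)⁻¹ • pv z x) U) ∧
    FrameField U p q (fun x => pv p x / q x) (fun x => curv1 z x * p x) (fun x => pu q x / p x)
      (fun x => curv2 z x * q x) z (fun x => (p x)⁻¹ • pu z x) (fun x => (q x)⁻¹ • pv z x)
      (normal z) := by
  obtain ⟨czu, czv⟩ := contDiffOn_partials (n := 2) (by exact_mod_cast hz.smooth) hU
  have cp : ContDiffOn ℝ 2 p U := contDiffOn_of_sq_eq (contDiffOn_ip czu czu).neg hp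
    fun x hx => by rw [show ip (pu z x) (pu z x) = -p x ^ 2 from hE x hx, neg_neg]
  have cq : ContDiffOn ℝ 2 q U := contDiffOn_of_sq_eq (contDiffOn_ip czv czv) hq hG
  set X := fun x => (p x)⁻¹ • pu z x with hXdef
  set Y := fun x => (q x)⁻¹ • pv z x with hYdef
  have cX : ContDiffOn ℝ 2 X U := (cp.inv fun x hx => (hp x hx).ne').smul czu
  have cY : ContDiffOn ℝ 2 Y U := (cq.inv fun x hx => (hq x hx).ne').smul czv
  have zuX : ∀ x ∈ U, pu z x = p x • X x := fun x hx => by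
    rw [hXdef, smul_inv_smul₀ (hp x hx).ne']
  have zvY : ∀ x ∈ U, pv z x = q x • Y x := fun x hx => by
    rw [hYdef, smul_inv_smul₀ (hq x hx).ne']
  have hl : ∀ x ∈ U, cross (X x) (Y x) = normal z x := by
    intro x hx
    have := hp x hx
    have := hq x hx
    unfold normal
    rw [ip_cross_cross, show ip (pu z x) (pv z x) = 0 from hz.F_zero x hx,
      show ip (pu z x) (pu z x) = _ from hE x hx, show ip (pv z x) (pv z x) = _ from hG x hx,
      show (0 : ℝ) ^ 2 - -p x ^ 2 * q x ^ 2 = (p x * q x) ^ 2 by ring,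
      Real.sqrt_sq (by positivity), hXdef, hYdef, cross_smul_smul, mul_inv]
  have cl : ContDiffOn ℝ 2 (normal z) U := (contDiffOn_cross cX cY).congr fun x hx => (hl x hx).symm
  have frame : ∀ x ∈ U, IsFrame (X x) (Y x) (normal z x) := by
    intro x hx
    have h1 := (hp x hx).ne'
    have h2 := (hq x hx).ne'
    refine ⟨?_, ?_, ?_, hl x hx⟩ <;> simp only [hXdef, hYdef, ip_smul_left, ip_smul_right]
    · rw [show ip (pu z x) (pu z x) = _ from hE x hx]; field_simp
    · rw [show ip (pv z x) (pv z x) = _ from hG x hx]; field_simp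
    · rw [show ip (pu z x) (pv z x) = 0 from hz.F_zero x hx]; ring
  refine ⟨⟨cp, cq⟩, ⟨cX, cY⟩, ?_⟩
  have main : ∀ x ∈ U, HasPartials X ((pv p x / q x) • Y x - (curv1 z x * p x) • normal z x)
        ((pu q x / p x) • Y x) x ∧
      HasPartials Y ((pv p x / q x) • X x)
        ((pu q x / p x) • X x + (curv2 z x * q x) • normal z x) x ∧
      HasPartials (normal z) (-((curv1 z x * p x) • X x)) (-((curv2 z x * q x) • Y x)) x := by
    intro x hx
    have p0 := (hp x hx).ne'
    have q0 := (hq x hx).ne'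
    have dX := hasPartials_of_contDiffOn cX (by simp) hU hx
    have dY := hasPartials_of_contDiffOn cY (by simp) hU hx
    have dl := hasPartials_of_contDiffOn cl (by simp) hU hx
    have dp := hasPartials_of_contDiffOn cp (by simp) hU hx
    have dq := hasPartials_of_contDiffOn cq (by simp) hU hx
    have dzu := (dp.smul dX).congr_on hU hx zuX
    have dzv := (dq.smul dY).congr_on hU hx zvY
    -- The components of `(p X)_v = (q Y)_u` along `X`, `Y`, `l` give `α`, `γ` and, through `M = 0`,
    -- the vanishing of the normal parts of `X_v` and `Y_u`. The definitions of `L` and `N` supply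
    -- `β` and `δ`.
    have symm := pv_pu_eq_pu_pv (hz.smooth.of_le (by norm_num)) hU hx
    rw [dzu.pv_eq, dzv.pu_eq] at symm
    have F := frame x hx
    have eXX := (dX.ip dX).eq_zero_of_eq_const hU hx fun y hy => (frame y hy).XX
    have eYY := (dY.ip dY).eq_zero_of_eq_const hU hx fun y hy => (frame y hy).YY
    have hM := hz.M_zero x hx
    have hL : curv1 z x * coefE z x = coefL z x := div_mul_cancel₀ _ (hz.E_neg x hx).ne
    have hN : curv2 z x * coefG z x = coefN z x := div_mul_cancel₀ _ (hz.G_pos x hx).ne'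
    unfold coefM at hM
    rw [hE x hx, coefL, dzu.pu_eq] at hL
    rw [hG x hx, coefN, dzv.pv_eq] at hN
    have sX := congrArg (ip (X x)) symm
    have sY := congrArg (ip (Y x)) symm
    have sl := congrArg (ip (normal z x)) symm
    rw [dzu.pv_eq] at hM
    rw [hM] at sl
    simp only [ip_add_right, ip_smul_right, F.XX, F.YY, F.XY, F.lX, F.lY, F.YX, mul_zero,
      zero_add] at sX sY sl hM hL hN
    have eXX2 : ip (X x) (pv X x) = 0 := by linarith [eXX.2, ip_comm (X x) (pv X x)]
    have eYY1 : ip (Y x) (pu Y x) = 0 := by linarith [eYY.1, ip_comm (Y x) (pu Y x)]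
    rw [eXX2] at sX
    rw [eYY1] at sY
    refine hasPartials_frame hU frame hx dX dY dl ?_ ?_ ?_ ?_ ?_ ?_
    · rw [ip_comm]; field_simp; linarith
    · apply mul_left_cancel₀ p0; linarith
    · exact (mul_eq_zero.1 sl.symm).resolve_left q0
    · rw [ip_comm]; field_simp; linarith
    · exact (mul_eq_zero.1 hM).resolve_left p0
    · apply mul_left_cancel₀ q0; linarith
  refine ⟨frame, fun x hx => ?_, fun x hx => (main x hx).1, fun x hx => (main x hx).2.1,
    fun x hx => (main x hx).2.2⟩
  exact (hasPartials_of_contDiffOn hz.smooth (by simp) hU hx).congr_partials (zuX x hx) (zvY x hx)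

/-- Differentiate the normal components `⟨l, X_u⟩ = -β` in `v` and `⟨l, X_v⟩ = 0` in `u`, then
cancel the mixed derivative of `X`; likewise for `Y`. Only `β` and `δ` get differentiated. -/
theorem FrameField.codazzi {U : Set (ℝ × ℝ)} (hU : IsOpen U)
    {p q α β γ δ : ℝ × ℝ → ℝ} {z X Y l : ℝ × ℝ → R31}
    (h : FrameField U p q α β γ δ z X Y l) (cX : ContDiffOn ℝ 2 X U) (cY : ContDiffOn ℝ 2 Y U)
    {x : ℝ × ℝ} (hx : x ∈ U) {βu βv δu δv : ℝ} (dβ : HasPartials β βu βv x)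
    (dδ : HasPartials δ δu δv x) : βv = δ x * α x ∧ δu = β x * γ x := by
  have cX1 := contDiffOn_partials (n := 1) (by exact_mod_cast cX) hU
  have cY1 := contDiffOn_partials (n := 1) (by exact_mod_cast cY) hU
  have dXu := hasPartials_of_contDiffOn cX1.1 (by simp) hU hx
  have dXv := hasPartials_of_contDiffOn cX1.2 (by simp) hU hx
  have dYu := hasPartials_of_contDiffOn cY1.1 (by simp) hU hx
  have dYv := hasPartials_of_contDiffOn cY1.2 (by simp) hU hx
  have sX := pv_pu_eq_pu_pv cX hU hx
  have sY := pv_pu_eq_pu_pv cY hU hx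
  have dl := h.dl x hx
  have F := h.frame x hx
  have key : ∀ y ∈ U, ip (l y) (pu X y) = -β y ∧ ip (l y) (pv X y) = 0 ∧
      ip (l y) (pu Y y) = 0 ∧ ip (l y) (pv Y y) = δ y := by
    intro y hy
    have F := h.frame y hy
    rw [(h.dX y hy).pu_eq, (h.dX y hy).pv_eq, (h.dY y hy).pu_eq, (h.dY y hy).pv_eq]
    simp only [ip_add_right, ip_sub_right, ip_smul_right, F.lX, F.lY, F.ll]
    refine ⟨?_, ?_, ?_, ?_⟩ <;> ring
  have k1 := ((dl.ip dXu).unique (dβ.neg.congr_on hU hx fun y hy => (key y hy).1)).2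
  have k2 := ((dl.ip dXv).eq_zero_of_eq_const hU hx fun y hy => (key y hy).2.1).1
  have k3 := ((dl.ip dYu).eq_zero_of_eq_const hU hx fun y hy => (key y hy).2.2.1).2
  have k4 := ((dl.ip dYv).unique (dδ.congr_on hU hx fun y hy => (key y hy).2.2.2)).1
  rw [← sX] at k2
  rw [← sY] at k4
  rw [(h.dX x hx).pu_eq] at k1
  rw [(h.dX x hx).pv_eq] at k2
  rw [(h.dY x hx).pu_eq] at k3
  rw [(h.dY x hx).pv_eq] at k4
  simp only [← neg_smul, ip_add_right, ip_sub_right, ip_smul_right, ip_smul_left, F.XX, F.XY,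
    F.YX, F.YY, F.Xl, F.Yl] at k1 k2 k3 k4
  constructor <;> linarith

end Codazzi

/-! ### The metric coefficients as functions of `ν` -/

section Scalar

theorem weight_pos (f g : ℝ → ℝ) (s₀ s : ℝ) : 0 < weight f g s₀ s := Real.exp_pos _

variable {I : Set ℝ} {f g : ℝ → ℝ} {m : ℕ∞}

theorem contDiffOn_deriv (hI : IsOpen I) (hf : ContDiffOn ℝ ((m : WithTop ℕ∞) + 1) f I) :
    ContDiffOn ℝ m (deriv f) I := ((contDiffOn_succ_iff_deriv_of_isOpen hI).1 hf).2.2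

theorem contDiffOn_deriv_div (hI : IsOpen I) (hf : ContDiffOn ℝ ((m : WithTop ℕ∞) + 1) f I)
    (hg : ContDiffOn ℝ ((m : WithTop ℕ∞) + 1) g I) (hfg : ∀ s ∈ I, f s - g s ≠ 0) :
    ContDiffOn ℝ m (fun t => deriv f t / (f t - g t)) I :=
  (contDiffOn_deriv hI hf).div ((hf.of_le le_self_add).sub (hg.of_le le_self_add)) hfg

theorem hasDerivAt_log_weight (hI : IsOpen I) (hIc : I.OrdConnected)
    (hf : ContDiffOn ℝ ((m : WithTop ℕ∞) + 1) f I)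
    (hg : ContDiffOn ℝ ((m : WithTop ℕ∞) + 1) g I) (hfg : ∀ s ∈ I, f s - g s ≠ 0)
    {s₀ s : ℝ} (hs₀ : s₀ ∈ I) (hs : s ∈ I) :
    HasDerivAt (fun s => ∫ t in s₀..s, deriv f t / (f t - g t)) (deriv f s / (f s - g s)) s := by
  have c := (contDiffOn_deriv_div hI hf hg hfg).continuousOn
  exact intervalIntegral.integral_hasDerivAt_right
    ((c.mono (hIc.uIcc_subset hs₀ hs)).intervalIntegrable)
    (c.stronglyMeasurableAtFilter hI s hs) (c.continuousAt (hI.mem_nhds hs))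

theorem contDiffOn_weight (hI : IsOpen I) (hIc : I.OrdConnected)
    (hf : ContDiffOn ℝ ((m : WithTop ℕ∞) + 1) f I)
    (hg : ContDiffOn ℝ ((m : WithTop ℕ∞) + 1) g I) (hfg : ∀ s ∈ I, f s - g s ≠ 0)
    {s₀ : ℝ} (hs₀ : s₀ ∈ I) : ContDiffOn ℝ ((m : WithTop ℕ∞) + 1) (weight f g s₀) I := by
  have d := fun s (hs : s ∈ I) => hasDerivAt_log_weight hI hIc hf hg hfg hs₀ hs
  refine ContDiffOn.exp ?_
  rw [contDiffOn_succ_iff_deriv_of_isOpen hI]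
  exact ⟨fun s hs => (d s hs).differentiableAt.differentiableWithinAt,
    fun h => absurd h (by simp),
    (contDiffOn_deriv_div hI hf hg hfg).congr fun s hs => (d s hs).deriv⟩

/-- The length factor of a natural parameter line, as a function of `ν`. -/
def lengthFactor (f g : ℝ → ℝ) (s₀ c s : ℝ) : ℝ := (c * weight f g s₀ s)⁻¹

theorem lengthFactor_pos (f g : ℝ → ℝ) (s₀ : ℝ) {c : ℝ} (hc : 0 < c) (s : ℝ) :
    0 < lengthFactor f g s₀ c s := inv_pos.2 (mul_pos hc (weight_pos f g s₀ s))

theorem contDiffOn_lengthFactor (hI : IsOpen I) (hIc : I.OrdConnected)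
    (hf : ContDiffOn ℝ ((m : WithTop ℕ∞) + 1) f I)
    (hg : ContDiffOn ℝ ((m : WithTop ℕ∞) + 1) g I) (hfg : ∀ s ∈ I, f s - g s ≠ 0)
    {s₀ c : ℝ} (hs₀ : s₀ ∈ I) (hc : 0 < c) :
    ContDiffOn ℝ ((m : WithTop ℕ∞) + 1) (lengthFactor f g s₀ c) I :=
  (contDiffOn_const.mul (contDiffOn_weight hI hIc hf hg hfg hs₀)).inv
    fun s _ => (mul_pos hc (weight_pos f g s₀ s)).ne'

theorem hasDerivAt_lengthFactor (hI : IsOpen I) (hIc : I.OrdConnected)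
    (hf : ContDiffOn ℝ ((m : WithTop ℕ∞) + 1) f I)
    (hg : ContDiffOn ℝ ((m : WithTop ℕ∞) + 1) g I) (hfg : ∀ s ∈ I, f s - g s ≠ 0)
    {s₀ c s : ℝ} (hs₀ : s₀ ∈ I) (hc : 0 < c) (hs : s ∈ I) :
    HasDerivAt (lengthFactor f g s₀ c)
      (-(deriv f s / (f s - g s)) * lengthFactor f g s₀ c s) s := by
  have hw : 0 < weight f g s₀ s := weight_pos f g s₀ s
  have h0 : c * weight f g s₀ s ≠ 0 := (mul_pos hc hw).ne'
  have h1 : HasDerivAt (weight f g s₀) (weight f g s₀ s * (deriv f s / (f s - g s))) s :=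
    (hasDerivAt_log_weight hI hIc hf hg hfg hs₀ hs).exp
  refine ((h1.const_mul c).fun_inv h0).congr_deriv ?_
  unfold lengthFactor
  field_simp

/-- The ratio `p_v / (q ν_v)` for the length factors `p` and `q`. -/
def factorRatio (f g : ℝ → ℝ) (s₀ c d s : ℝ) : ℝ :=
  -(deriv f s / (f s - g s)) * (lengthFactor f g s₀ c s / lengthFactor g f s₀ d s)

theorem sub_ne_zero_symm (hfg : ∀ s ∈ I, f s - g s ≠ 0) : ∀ s ∈ I, g s - f s ≠ 0 :=
  fun s hs => sub_ne_zero.2 (sub_ne_zero.1 (hfg s hs)).symm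

theorem contDiffOn_factorRatio (hI : IsOpen I) (hIc : I.OrdConnected)
    (hf : ContDiffOn ℝ ((m : WithTop ℕ∞) + 1) f I)
    (hg : ContDiffOn ℝ ((m : WithTop ℕ∞) + 1) g I) (hfg : ∀ s ∈ I, f s - g s ≠ 0)
    {s₀ c d : ℝ} (hs₀ : s₀ ∈ I) (hc : 0 < c) (hd : 0 < d) :
    ContDiffOn ℝ m (factorRatio f g s₀ c d) I :=
  (contDiffOn_deriv_div hI hf hg hfg).neg.mul
    (((contDiffOn_lengthFactor hI hIc hf hg hfg hs₀ hc).of_le le_self_add).div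
      ((contDiffOn_lengthFactor hI hIc hg hf (sub_ne_zero_symm hfg) hs₀ hd).of_le le_self_add)
      fun s _ => (lengthFactor_pos g f s₀ hd s).ne')

/-- The terms with `g'` from the quotient `f' / (f - g)` and from the ratio of length factors
cancel. What remains is the bracket multiplying `ν_v²` in the natural equation. -/
theorem hasDerivAt_factorRatio (hI : IsOpen I) (hIc : I.OrdConnected) (hm : 1 ≤ m)
    (hf : ContDiffOn ℝ ((m : WithTop ℕ∞) + 1) f I)
    (hg : ContDiffOn ℝ ((m : WithTop ℕ∞) + 1) g I) (hfg : ∀ s ∈ I, f s - g s ≠ 0)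
    {s₀ c d s : ℝ} (hs₀ : s₀ ∈ I) (hc : 0 < c) (hd : 0 < d) (hs : s ∈ I) :
    HasDerivAt (factorRatio f g s₀ c d)
      (-(lengthFactor f g s₀ c s / lengthFactor g f s₀ d s) / (f s - g s) *
        (deriv (deriv f) s - 2 * deriv f s ^ 2 / (f s - g s))) s := by
  have hm0 : (m : WithTop ℕ∞) ≠ 0 := by
    have : m ≠ 0 := (zero_lt_one.trans_le hm).ne'
    exact_mod_cast this
  have df := ((hf.differentiableOn (by simp)).differentiableAt (hI.mem_nhds hs)).hasDerivAt
  have dg := ((hg.differentiableOn (by simp)).differentiableAt (hI.mem_nhds hs)).hasDerivAt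
  have ddf := (((contDiffOn_deriv hI hf).differentiableOn hm0).differentiableAt
    (hI.mem_nhds hs)).hasDerivAt
  have n1 := hfg s hs
  have n2 := sub_ne_zero_symm hfg s hs
  have n3 := (lengthFactor_pos g f s₀ hd s).ne'
  refine ((ddf.fun_div (df.fun_sub dg) n1).fun_neg.fun_mul
    ((hasDerivAt_lengthFactor hI hIc hf hg hfg hs₀ hc hs).fun_div
    (hasDerivAt_lengthFactor hI hIc hg hf (sub_ne_zero_symm hfg) hs₀ hd hs) n3)).congr_deriv ?_
  have e : g s - f s = -(f s - g s) := by ring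
  rw [e]
  generalize f s - g s = w at n1 ⊢
  field_simp
  ring

end Scalar

/-! ### The metric of a solution is forced -/

section Solutions

variable {I : Set ℝ} {f g : ℝ → ℝ} {m : ℕ∞} {U : Set (ℝ × ℝ)} {ν : ℝ × ℝ → ℝ}

theorem FrameField.congr {p q α β γ δ α' β' γ' δ' : ℝ × ℝ → ℝ} {z X Y l : ℝ × ℝ → R31}
    (h : FrameField U p q α β γ δ z X Y l) (hα : ∀ x ∈ U, α x = α' x)
    (hβ : ∀ x ∈ U, β x = β' x) (hγ : ∀ x ∈ U, γ x = γ' x) (hδ : ∀ x ∈ U, δ x = δ' x) :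
    FrameField U p q α' β' γ' δ' z X Y l where
  frame := h.frame
  dz := h.dz
  dX x hx := hα x hx ▸ hβ x hx ▸ hγ x hx ▸ h.dX x hx
  dY x hx := hα x hx ▸ hδ x hx ▸ hγ x hx ▸ h.dY x hx
  dl x hx := hβ x hx ▸ hδ x hx ▸ h.dl x hx

/-- The Codazzi equations determine the metric of a Weingarten surface with prescribed principal
geodesic curvatures. -/
theorem IsSolution.metric_eq (hI : IsOpen I) (hf : ContDiffOn ℝ ((m : WithTop ℕ∞) + 1) f I)
    (hg : ContDiffOn ℝ ((m : WithTop ℕ∞) + 1) g I) (hfg : ∀ s ∈ I, f s - g s ≠ 0)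
    (hfg' : ∀ s ∈ I, deriv f s * deriv g s ≠ 0) (hU : IsOpen U)
    (hν : ContDiffOn ℝ ((m : WithTop ℕ∞) + 1) ν U) (hνI : ∀ x ∈ U, ν x ∈ I)
    (hν' : ∀ x ∈ U, pu ν x * pv ν x ≠ 0) {s₀ a b : ℝ} {z : ℝ × ℝ → R31}
    (h : IsSolution f g ν s₀ a b U z) {x : ℝ × ℝ} (hx : x ∈ U) :
    coefE z x = -lengthFactor f g s₀ |a| (ν x) ^ 2 ∧
      coefG z x = lengthFactor g f s₀ |b| (ν x) ^ 2 := by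
  have hz := h.stronglyRegular.toIsPrincipalTimelike
  set p := fun x => Real.sqrt (-coefE z x) with hpdef
  set q := fun x => Real.sqrt (coefG z x) with hqdef
  have hp : ∀ x ∈ U, 0 < p x := fun x hx => Real.sqrt_pos.2 (neg_pos.2 (hz.E_neg x hx))
  have hq : ∀ x ∈ U, 0 < q x := fun x hx => Real.sqrt_pos.2 (hz.G_pos x hx)
  have hE : ∀ x ∈ U, coefE z x = -p x ^ 2 := fun x hx => by
    rw [hpdef, Real.sq_sqrt (neg_pos.2 (hz.E_neg x hx)).le, neg_neg]
  have hG : ∀ x ∈ U, coefG z x = q x ^ 2 := fun x hx => by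
    rw [hqdef, Real.sq_sqrt (hz.G_pos x hx).le]
  obtain ⟨⟨cp, cq⟩, ⟨cX, cY⟩, F⟩ := hz.frameField hU hp hq hE hG
  have hs := hνI x hx
  have dν := hasPartials_of_contDiffOn hν (by simp) hU hx
  have dp := hasPartials_of_contDiffOn cp (by simp) hU hx
  have dq := hasPartials_of_contDiffOn cq (by simp) hU hx
  have df := ((hf.differentiableOn (by simp)).differentiableAt (hI.mem_nhds hs)).hasDerivAt
  have dg := ((hg.differentiableOn (by simp)).differentiableAt (hI.mem_nhds hs)).hasDerivAt
  have dβ := ((dν.scomp df).mul dp).congr_on hU hx (h' := fun x => curv1 z x * p x)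
    fun y hy => by rw [(h.weingarten y hy).1]
  have dδ := ((dν.scomp dg).mul dq).congr_on hU hx (h' := fun x => curv2 z x * q x)
    fun y hy => by rw [(h.weingarten y hy).2]
  obtain ⟨k1, k2⟩ := F.codazzi hU cX cY hx dβ dδ
  simp only [(h.weingarten x hx).1, (h.weingarten x hx).2] at k1 k2
  have p0 := hp x hx
  have q0 := hq x hx
  have n := hfg _ hs
  have g1 := h.geod1_eq x hx
  have g2 := h.geod2_eq x hx
  have Ev := ((dp.mul dp).neg.congr_on hU hx (h' := coefE z) fun y hy => by
    rw [hE y hy, sq]).pv_eq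
  have Gu := ((dq.mul dq).congr_on hU hx (h' := coefG z) fun y hy => by
    rw [hG y hy, sq]).pu_eq
  unfold geod1 at g1
  unfold geod2 at g2
  rw [Ev, show √(coefG z x) = q x from rfl, hE x hx] at g1
  rw [Gu, show √(-coefE z x) = p x from rfl, hG x hx] at g2
  have hψ := weight_pos g f s₀ (ν x)
  have hφ := weight_pos f g s₀ (ν x)
  have nf := left_ne_zero_of_mul (hfg' _ hs)
  have ng := right_ne_zero_of_mul (hfg' _ hs)
  have nu := left_ne_zero_of_mul (hν' x hx)
  have nv := right_ne_zero_of_mul (hν' x hx)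
  have pv_p : pv p x * (f (ν x) - g (ν x)) = -(deriv f (ν x) * pv ν x * p x) := by
    field_simp at k1
    linarith
  have pu_q : pu q x * (f (ν x) - g (ν x)) = deriv g (ν x) * pu ν x * q x := by
    field_simp at k2
    linarith
  -- Codazzi has replaced `p_v` by `-f' ν_v p / (f - g)`, so the prescribed `γ₁` becomes an equation
  -- for `q` alone after cancelling `f' ν_v p`.
  have hb : q x * (|b| * weight g f s₀ (ν x)) = 1 := by
    field_simp at g1
    apply mul_left_cancel₀ (mul_ne_zero (mul_ne_zero nf nv) p0.ne')
    linarith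
  have ha : p x * (|a| * weight f g s₀ (ν x)) = 1 := by
    field_simp at g2
    apply mul_left_cancel₀ (mul_ne_zero (mul_ne_zero ng nu) q0.ne')
    linarith
  unfold lengthFactor
  rw [hE x hx, hG x hx, eq_inv_of_mul_eq_one_left ha, eq_inv_of_mul_eq_one_left hb]
  exact ⟨rfl, rfl⟩

end Solutions

/-! ### Integration of the structure equations -/

section Existence

/-- The vectors `(X, Y, l, z)` of a moving frame with its base point. -/
abbrev FrameSpace : Type := R31 × R31 × R31 × R31

/-- Rotation in the plane of `X` and `Y`. -/
def rotXY : FrameSpace →L[ℝ] FrameSpace :=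
  (ContinuousLinearMap.fst ℝ _ _ ∘L ContinuousLinearMap.snd ℝ _ _).prod
    ((ContinuousLinearMap.fst ℝ _ _).prod 0)

/-- Rotation in the plane of `X` and `l`. -/
def rotXl : FrameSpace →L[ℝ] FrameSpace :=
  (-(ContinuousLinearMap.fst ℝ _ _ ∘L ContinuousLinearMap.snd ℝ _ _ ∘L
    ContinuousLinearMap.snd ℝ _ _)).prod
    ((0 : FrameSpace →L[ℝ] R31).prod ((-(ContinuousLinearMap.fst ℝ _ _)).prod 0))

/-- Rotation in the plane of `Y` and `l`. -/
def rotYl : FrameSpace →L[ℝ] FrameSpace :=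
  (0 : FrameSpace →L[ℝ] R31).prod ((ContinuousLinearMap.fst ℝ _ _ ∘L
    ContinuousLinearMap.snd ℝ _ _ ∘L ContinuousLinearMap.snd ℝ _ _).prod
    ((-(ContinuousLinearMap.fst ℝ _ _ ∘L ContinuousLinearMap.snd ℝ _ _)).prod 0))

/-- Translation of the base point along `X`. -/
def transX : FrameSpace →L[ℝ] FrameSpace :=
  (0 : FrameSpace →L[ℝ] R31).prod ((0 : FrameSpace →L[ℝ] R31).prod
    ((0 : FrameSpace →L[ℝ] R31).prod (ContinuousLinearMap.fst ℝ _ _)))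

/-- Translation of the base point along `Y`. -/
def transY : FrameSpace →L[ℝ] FrameSpace :=
  (0 : FrameSpace →L[ℝ] R31).prod ((0 : FrameSpace →L[ℝ] R31).prod
    ((0 : FrameSpace →L[ℝ] R31).prod
      (ContinuousLinearMap.fst ℝ _ _ ∘L ContinuousLinearMap.snd ℝ _ _)))

theorem rotXY_apply (X Y l z : R31) : rotXY (X, Y, l, z) = (Y, X, 0, 0) := rfl

theorem rotXl_apply (X Y l z : R31) : rotXl (X, Y, l, z) = (-l, 0, -X, 0) := rfl

theorem rotYl_apply (X Y l z : R31) : rotYl (X, Y, l, z) = (0, l, -Y, 0) := rfl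

theorem transX_apply (X Y l z : R31) : transX (X, Y, l, z) = (0, 0, 0, X) := rfl

theorem transY_apply (X Y l z : R31) : transY (X, Y, l, z) = (0, 0, 0, Y) := rfl

/-- Bootstrap: if `Φ` is `C^n` with `n ≤ m`, its partial derivatives `P Φ` and `Q Φ` are `C^n`, so
`Φ` is `C^(n+1)`. Induction over natural orders also covers `m = ∞`. -/
theorem contDiffOn_linear_system {V : Type*} [NormedAddCommGroup V] [NormedSpace ℝ V]
    {U : Set (ℝ × ℝ)} (hU : IsOpen U) {P Q : ℝ × ℝ → V →L[ℝ] V} {m : ℕ∞}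
    (hP : ContDiffOn ℝ m P U) (hQ : ContDiffOn ℝ m Q U) {Φ : ℝ × ℝ → V}
    (h : ∀ x ∈ U, HasPartials Φ (P x (Φ x)) (Q x (Φ x)) x) :
    ContDiffOn ℝ ((m : WithTop ℕ∞) + 1) Φ U := by
  have step : ∀ n : ℕ∞, n ≤ m → ContDiffOn ℝ n Φ U → ContDiffOn ℝ ((n : WithTop ℕ∞) + 1) Φ U :=
    fun n hn hΦ => contDiffOn_succ_of_hasPartials hU h
      ((hP.of_le (by exact_mod_cast hn)).clm_apply hΦ)
      ((hQ.of_le (by exact_mod_cast hn)).clm_apply hΦ)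
  refine step m le_rfl (contDiffOn_iff_forall_nat_le.2 fun n => ?_)
  induction n with
  | zero =>
    intro _
    refine contDiffOn_zero.2 fun x hx => ?_
    exact (HasFDerivAt.continuousAt (h x hx)).continuousWithinAt
  | succ n ih =>
    intro hn
    have h1 : (n : ℕ∞) ≤ m := le_trans (by exact_mod_cast n.le_succ) hn
    exact_mod_cast step n h1 (by exact_mod_cast ih h1)

/-- Existence of a surface with a moving frame obeying prescribed structure equations. -/
theorem exists_frameField {U : Set (ℝ × ℝ)} (hU : IsOpen U) {m : ℕ∞} (hm : 1 ≤ m)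
    {p q α β γ δ : ℝ × ℝ → ℝ}
    (cp : ContDiffOn ℝ ((m : WithTop ℕ∞) + 1) p U) (cq : ContDiffOn ℝ ((m : WithTop ℕ∞) + 1) q U)
    (cα : ContDiffOn ℝ m α U) (cβ : ContDiffOn ℝ m β U)
    (cγ : ContDiffOn ℝ m γ U) (cδ : ContDiffOn ℝ m δ U)
    (hp : ∀ x ∈ U, pv p x = α x * q x) (hq : ∀ x ∈ U, pu q x = γ x * p x)
    (hβ : ∀ x ∈ U, pv β x = δ x * α x) (hδ : ∀ x ∈ U, pu δ x = β x * γ x)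
    (gauss : ∀ x ∈ U, pu γ x = pv α x + β x * δ x) {x₀ : ℝ × ℝ} (hx₀ : x₀ ∈ U) :
    ∃ r > 0, Metric.ball x₀ r ⊆ U ∧ ∃ z X Y l : ℝ × ℝ → R31,
      FrameField (Metric.ball x₀ r) p q α β γ δ z X Y l ∧
      ContDiffOn ℝ ((m : WithTop ℕ∞) + 1 + 1) z (Metric.ball x₀ r) := by
  have hm0 : (m : WithTop ℕ∞) ≠ 0 := by
    have : m ≠ 0 := (zero_lt_one.trans_le hm).ne'
    exact_mod_cast this
  have hm1 : (1 : WithTop ℕ∞) ≤ m := by exact_mod_cast hm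
  have cp' : ContDiffOn ℝ m p U := cp.of_le le_self_add
  have cq' : ContDiffOn ℝ m q U := cq.of_le le_self_add
  let P : ℝ × ℝ → FrameSpace →L[ℝ] FrameSpace := fun x => α x • rotXY + β x • rotXl + p x • transX
  let Q : ℝ × ℝ → FrameSpace →L[ℝ] FrameSpace := fun x => γ x • rotXY + δ x • rotYl + q x • transY
  have cP : ContDiffOn ℝ m P U := ((cα.smul contDiffOn_const).add
    (cβ.smul contDiffOn_const)).add (cp'.smul contDiffOn_const)
  have cQ : ContDiffOn ℝ m Q U := ((cγ.smul contDiffOn_const).add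
    (cδ.smul contDiffOn_const)).add (cq'.smul contDiffOn_const)
  -- Comparing coefficients of `X`, `Y`, `l` in the two mixed derivatives leaves exactly the Gauss
  -- and Codazzi equations and the two closing conditions for `z`.
  have compat : ∀ x ∈ U, pv P x + P x ∘L Q x = pu Q x + Q x ∘L P x := by
    intro x hx
    have d : ∀ {h : ℝ × ℝ → ℝ}, ContDiffOn ℝ m h U → ∀ L : FrameSpace →L[ℝ] FrameSpace,
        HasPartials (fun x => h x • L) (pu h x • L + h x • 0) (pv h x • L + h x • 0) x :=
      fun hh L => (hasPartials_of_contDiffOn hh hm0 hU hx).smul (hasPartials_const L x)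
    rw [(((d cα rotXY).add (d cβ rotXl)).add (d cp' transX)).pv_eq,
      (((d cγ rotXY).add (d cδ rotYl)).add (d cq' transY)).pu_eq, hp x hx, hq x hx, hβ x hx,
      hδ x hx, gauss x hx]
    refine ContinuousLinearMap.ext fun ⟨X, Y, l, z⟩ => ?_
    simp only [P, Q, add_apply, smul_apply,
      ContinuousLinearMap.comp_apply, smul_zero, add_zero, rotXY_apply, rotXl_apply, rotYl_apply,
      transX_apply, transY_apply, Prod.smul_mk, Prod.mk_add_mk]
    refine Prod.ext ?_ (Prod.ext ?_ (Prod.ext ?_ ?_)) <;> dsimp only <;> module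
  let X₀ : R31 := ![0, 0, 1]
  let Y₀ : R31 := ![1, 0, 0]
  have F₀ : IsFrame X₀ Y₀ (cross X₀ Y₀) := by
    refine ⟨?_, ?_, ?_, rfl⟩ <;> simp [ip, X₀, Y₀]
  obtain ⟨r, hr, hsub, Φ, hΦ₀, hΦ⟩ := exists_solution_of_compatible_linear_system hU
    (cP.of_le hm1) (cQ.of_le hm1) compat hx₀ (X₀, Y₀, cross X₀ Y₀, 0)
  have cΦ := contDiffOn_linear_system Metric.isOpen_ball (cP.mono hsub) (cQ.mono hsub) hΦ
  let X := fun x => (Φ x).1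
  let Y := fun x => (Φ x).2.1
  let l := fun x => (Φ x).2.2.1
  let z := fun x => (Φ x).2.2.2
  have dX : ∀ x ∈ Metric.ball x₀ r, HasPartials X (α x • Y x - β x • l x) (γ x • Y x) x :=
    fun x hx => ((hΦ x hx).clm (ContinuousLinearMap.fst ℝ R31 (R31 × R31 × R31))).congr_partials
      (by change α x • Y x + β x • -l x + p x • (0 : R31) = _; module)
      (by change γ x • Y x + δ x • (0 : R31) + q x • (0 : R31) = _; module)
  have dY : ∀ x ∈ Metric.ball x₀ r, HasPartials Y (α x • X x) (γ x • X x + δ x • l x) x :=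
    fun x hx => ((hΦ x hx).clm (ContinuousLinearMap.fst ℝ R31 (R31 × R31) ∘L
      ContinuousLinearMap.snd ℝ R31 (R31 × R31 × R31))).congr_partials
      (by change α x • X x + β x • (0 : R31) + p x • (0 : R31) = _; module)
      (by change γ x • X x + δ x • l x + q x • (0 : R31) = _; module)
  have dl : ∀ x ∈ Metric.ball x₀ r, HasPartials l (-(β x • X x)) (-(δ x • Y x)) x :=
    fun x hx => ((hΦ x hx).clm (ContinuousLinearMap.fst ℝ R31 R31 ∘L
      ContinuousLinearMap.snd ℝ R31 (R31 × R31) ∘L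
      ContinuousLinearMap.snd ℝ R31 (R31 × R31 × R31))).congr_partials
      (by change α x • (0 : R31) + β x • -X x + p x • (0 : R31) = _; module)
      (by change γ x • (0 : R31) + δ x • -Y x + q x • (0 : R31) = _; module)
  have dz : ∀ x ∈ Metric.ball x₀ r, HasPartials z (p x • X x) (q x • Y x) x :=
    fun x hx => ((hΦ x hx).clm (ContinuousLinearMap.snd ℝ R31 R31 ∘L
      ContinuousLinearMap.snd ℝ R31 (R31 × R31) ∘L
      ContinuousLinearMap.snd ℝ R31 (R31 × R31 × R31))).congr_partials
      (by change α x • (0 : R31) + β x • (0 : R31) + p x • X x = _; module)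
      (by change γ x • (0 : R31) + δ x • (0 : R31) + q x • Y x = _; module)
  have hpre : IsPreconnected (Metric.ball x₀ r) := (convex_ball x₀ r).isPreconnected
  have mem₀ : x₀ ∈ Metric.ball x₀ r := Metric.mem_ball_self hr
  have X₀e : X x₀ = X₀ := congrArg (fun v : FrameSpace => v.1) hΦ₀
  have Y₀e : Y x₀ = Y₀ := congrArg (fun v : FrameSpace => v.2.1) hΦ₀
  have l₀e : l x₀ = cross X₀ Y₀ := congrArg (fun v : FrameSpace => v.2.2.1) hΦ₀
  -- Transporting the frame to itself gives a constant map, which is the identity at `x₀`.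
  have complete : ∀ x ∈ Metric.ball x₀ r, ∀ y,
      (-ip (X x) y) • X x + ip (Y x) y • Y x + ip (l x) y • l x = y := by
    intro x hx y
    obtain ⟨c, hc⟩ := exists_eq_const_of_hasPartials_zero Metric.isOpen_ball hpre
      (frame_transport_constant dX dY dl dX dY dl y)
    rw [hc x hx, ← hc x₀ mem₀, X₀e, Y₀e, l₀e]
    exact (F₀.expand y).symm
  have det : ∀ x ∈ Metric.ball x₀ r, ip (cross (X x) (Y x)) (l x) = 1 := by
    intro x hx
    obtain ⟨c, hc⟩ := exists_eq_const_of_hasPartials_zero Metric.isOpen_ball hpre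
      (h := fun x => ip (cross (X x) (Y x)) (l x)) (by
      intro x hx
      have X0 := (dX x hx).coord 0
      have X1 := (dX x hx).coord 1
      have X2 := (dX x hx).coord 2
      have Y0 := (dY x hx).coord 0
      have Y1 := (dY x hx).coord 1
      have Y2 := (dY x hx).coord 2
      have l0 := (dl x hx).coord 0
      have l1 := (dl x hx).coord 1
      have l2 := (dl x hx).coord 2
      simp only [ip, cross_zero, cross_one, cross_two]
      refine (((((X1.mul Y2).sub (X2.mul Y1)).mul l0).add
        (((X2.mul Y0).sub (X0.mul Y2)).mul l1)).sub
        (((X0.mul Y1).sub (X1.mul Y0)).neg.mul l2)).congr_partials ?_ ?_ <;>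
      simp only [Pi.add_apply, Pi.sub_apply, Pi.smul_apply, Pi.neg_apply, smul_eq_mul] <;> ring)
    rw [hc x hx, ← hc x₀ mem₀, X₀e, Y₀e, l₀e]
    exact F₀.ll
  refine ⟨r, hr, hsub, z, X, Y, l, ⟨fun x hx => IsFrame.of_completeness (complete x hx) (det x hx),
    dz, dX, dY, dl⟩, ?_⟩
  -- The partial derivatives `p X` and `q Y` are `C^(m+1)`, since `p`, `q` and the frame are, so `z`
  -- gains one further order over the frame.
  exact contDiffOn_succ_of_hasPartials (n := m + 1) Metric.isOpen_ball dz
    (by exact_mod_cast (cp.mono hsub).smul cΦ.fst)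
    (by exact_mod_cast (cq.mono hsub).smul cΦ.snd.fst)

/-- The invariants of a surface carrying a frame field. -/
theorem FrameField.invariants {U : Set (ℝ × ℝ)} (hU : IsOpen U)
    {p q α β γ δ : ℝ × ℝ → ℝ} {z X Y l : ℝ × ℝ → R31}
    (h : FrameField U p q α β γ δ z X Y l) (hp0 : ∀ x ∈ U, 0 < p x) (hq0 : ∀ x ∈ U, 0 < q x)
    (dp : ∀ x ∈ U, HasPartials p (pu p x) (pv p x) x)
    (dq : ∀ x ∈ U, HasPartials q (pu q x) (pv q x) x) {x : ℝ × ℝ} (hx : x ∈ U) :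
    (coefE z x = -p x ^ 2 ∧ coefG z x = q x ^ 2 ∧ coefF z x = 0 ∧ coefM z x = 0) ∧
      curv1 z x = β x / p x ∧ curv2 z x = δ x / q x ∧
      geod1 z x = pv p x / (p x * q x) ∧ geod2 z x = -pu q x / (p x * q x) := by
  have zu : ∀ x ∈ U, pu z x = p x • X x := fun x hx => (h.dz x hx).pu_eq
  have zv : ∀ x ∈ U, pv z x = q x • Y x := fun x hx => (h.dz x hx).pv_eq
  have hE : ∀ x ∈ U, coefE z x = -(p x * p x) := fun x hx => by
    rw [coefE, zu x hx, ip_smul_left, ip_smul_right, (h.frame x hx).XX]; ring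
  have hG : ∀ x ∈ U, coefG z x = q x * q x := fun x hx => by
    rw [coefG, zv x hx, ip_smul_left, ip_smul_right, (h.frame x hx).YY]; ring
  have F := h.frame x hx
  have p0 := hp0 x hx
  have q0 := hq0 x hx
  have hF : coefF z x = 0 := by
    rw [coefF, zu x hx, zv x hx, ip_smul_left, ip_smul_right, F.XY]; ring
  have hl : normal z x = l x := by
    unfold normal
    rw [ip_cross_cross, show ip (pu z x) (pv z x) = 0 from hF,
      show ip (pu z x) (pu z x) = _ from hE x hx, show ip (pv z x) (pv z x) = _ from hG x hx,
      show (0 : ℝ) ^ 2 - -(p x * p x) * (q x * q x) = (p x * q x) ^ 2 by ring,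
      Real.sqrt_sq (by positivity), zu x hx, zv x hx, cross_smul_smul,
      inv_smul_smul₀ (by positivity), F.cross_eq]
  have dzu := ((dp x hx).smul (h.dX x hx)).congr_on hU hx zu
  have dzv := ((dq x hx).smul (h.dY x hx)).congr_on hU hx zv
  have dE := ((dp x hx).mul (dp x hx)).neg.congr_on hU hx hE
  have dG := ((dq x hx).mul (dq x hx)).congr_on hU hx hG
  refine ⟨⟨by rw [hE x hx]; ring, by rw [hG x hx]; ring, hF, ?_⟩, ?_, ?_, ?_, ?_⟩
  · rw [coefM, hl, dzu.pv_eq]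
    simp only [ip_add_right, ip_smul_right, F.lX, F.lY]; ring
  · rw [curv1, coefL, hl, dzu.pu_eq, hE x hx]
    simp only [ip_add_right, ip_sub_right, ip_smul_right, F.lX, F.lY, F.ll]
    field_simp; ring
  · rw [curv2, coefN, hl, dzv.pv_eq, hG x hx]
    simp only [ip_add_right, ip_smul_right, F.lX, F.lY, F.ll]
    field_simp; ring
  · rw [geod1, dE.pv_eq, hE x hx, hG x hx, Real.sqrt_mul_self q0.le]
    field_simp; ring
  · rw [geod2, dG.pu_eq, hE x hx, hG x hx, neg_neg, Real.sqrt_mul_self p0.le]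
    field_simp; ring

end Existence

/-! ### Naturality, uniqueness and existence of solutions -/

section NaturalParameters

variable {I : Set ℝ} {f g : ℝ → ℝ} {m : ℕ∞} {U : Set (ℝ × ℝ)} {ν : ℝ × ℝ → ℝ}

theorem IsSolution.isNatural (hI : IsOpen I) (hf : ContDiffOn ℝ ((m : WithTop ℕ∞) + 1) f I)
    (hg : ContDiffOn ℝ ((m : WithTop ℕ∞) + 1) g I) (hfg : ∀ s ∈ I, f s - g s ≠ 0)
    (hfg' : ∀ s ∈ I, deriv f s * deriv g s ≠ 0) (hU : IsOpen U)
    (hν : ContDiffOn ℝ ((m : WithTop ℕ∞) + 1) ν U) (hνI : ∀ x ∈ U, ν x ∈ I)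
    (hν' : ∀ x ∈ U, pu ν x * pv ν x ≠ 0) {s₀ a b : ℝ} (ha : a ≠ 0) (hb : b ≠ 0)
    {z : ℝ × ℝ → R31} (h : IsSolution f g ν s₀ a b U z) : IsNatural f g ν s₀ U z := by
  have metric := fun x hx => h.metric_eq hI hf hg hfg hfg' hU hν hνI hν' (x := x) hx
  refine ⟨⟨|a|⁻¹, fun x hx => ?_⟩, ⟨|b|⁻¹, fun x hx => ?_⟩⟩
  · rw [(metric x hx).1, neg_neg, Real.sqrt_sq (lengthFactor_pos f g s₀ (abs_pos.2 ha) _).le,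
      lengthFactor, mul_inv, inv_mul_cancel_right₀ (weight_pos f g s₀ (ν x)).ne']
  · rw [(metric x hx).2, Real.sqrt_sq (lengthFactor_pos g f s₀ (abs_pos.2 hb) _).le,
      lengthFactor, mul_inv, inv_mul_cancel_right₀ (weight_pos g f s₀ (ν x)).ne']

/-- Once the metric is forced, all six functions in the structure equations are expressed through
`f`, `g`, `ν` and the constants, hence are common to both surfaces. -/
theorem IsSolution.exists_motion (hI : IsOpen I) (hf : ContDiffOn ℝ ((m : WithTop ℕ∞) + 1) f I)
    (hg : ContDiffOn ℝ ((m : WithTop ℕ∞) + 1) g I) (hfg : ∀ s ∈ I, f s - g s ≠ 0)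
    (hfg' : ∀ s ∈ I, deriv f s * deriv g s ≠ 0) (hU : IsOpen U) (hc : IsConnected U)
    (hν : ContDiffOn ℝ ((m : WithTop ℕ∞) + 1) ν U) (hνI : ∀ x ∈ U, ν x ∈ I)
    (hν' : ∀ x ∈ U, pu ν x * pv ν x ≠ 0) {s₀ a b : ℝ} (ha : a ≠ 0) (hb : b ≠ 0)
    {z w : ℝ × ℝ → R31} (hz : IsSolution f g ν s₀ a b U z) (hw : IsSolution f g ν s₀ a b U w) :
    ∃ T : R31 → R31, IsMotion T ∧ ∀ x ∈ U, w x = T (z x) := by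
  have frame : ∀ {y : ℝ × ℝ → R31}, IsSolution f g ν s₀ a b U y → ∃ X Y l, FrameField U
      (fun x => lengthFactor f g s₀ |a| (ν x)) (fun x => lengthFactor g f s₀ |b| (ν x))
      (fun x => pv (fun x => lengthFactor f g s₀ |a| (ν x)) x / lengthFactor g f s₀ |b| (ν x))
      (fun x => f (ν x) * lengthFactor f g s₀ |a| (ν x))
      (fun x => pu (fun x => lengthFactor g f s₀ |b| (ν x)) x / lengthFactor f g s₀ |a| (ν x))
      (fun x => g (ν x) * lengthFactor g f s₀ |b| (ν x)) y X Y l := by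
    intro y h
    have metric := fun x hx => h.metric_eq hI hf hg hfg hfg' hU hν hνI hν' (x := x) hx
    have F := (h.stronglyRegular.toIsPrincipalTimelike.frameField hU
      (fun x _ => lengthFactor_pos f g s₀ (abs_pos.2 ha) (ν x))
      (fun x _ => lengthFactor_pos g f s₀ (abs_pos.2 hb) (ν x))
      (fun x hx => (metric x hx).1) (fun x hx => (metric x hx).2)).2.2
    exact ⟨_, _, _, F.congr (fun _ _ => rfl) (fun x hx => by rw [(h.weingarten x hx).1])
      (fun _ _ => rfl) (fun x hx => by rw [(h.weingarten x hx).2])⟩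
  obtain ⟨X, Y, l, F⟩ := frame hz
  obtain ⟨X', Y', l', F'⟩ := frame hw
  exact F.exists_motion hU hc F'

/-- With the forced `p` and `q`, the closing conditions and the Codazzi equations are identities;
the natural equation enters only as the Gauss equation. -/
theorem exists_isSolution (hm : 1 ≤ m) (hI : IsOpen I) (hIc : I.OrdConnected)
    (hf : ContDiffOn ℝ ((m : WithTop ℕ∞) + 1) f I)
    (hg : ContDiffOn ℝ ((m : WithTop ℕ∞) + 1) g I) (hfg : ∀ s ∈ I, f s - g s ≠ 0)
    (hfg' : ∀ s ∈ I, deriv f s * deriv g s ≠ 0) (hU : IsOpen U)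
    (hν : ContDiffOn ℝ ((m : WithTop ℕ∞) + 1) ν U) (hνI : ∀ x ∈ U, ν x ∈ I)
    (hν' : ∀ x ∈ U, pu ν x * pv ν x ≠ 0) {s₀ a b : ℝ} (hs₀ : s₀ ∈ I) (ha : a ≠ 0) (hb : b ≠ 0)
    (hpde : ∀ x ∈ U, NaturalPDE f g ν s₀ a b x) {x₀ : ℝ × ℝ} (hx₀ : x₀ ∈ U) :
    ∃ r > 0, Metric.ball x₀ r ⊆ U ∧ ∃ z : ℝ × ℝ → R31,
      ContDiffOn ℝ ((m : WithTop ℕ∞) + 1 + 1) z (Metric.ball x₀ r) ∧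
        IsSolution f g ν s₀ a b (Metric.ball x₀ r) z := by
  have hm0 : (m : WithTop ℕ∞) ≠ 0 := by
    have : m ≠ 0 := (zero_lt_one.trans_le hm).ne'
    exact_mod_cast this
  have ha' := abs_pos.2 ha
  have hb' := abs_pos.2 hb
  have hgf := sub_ne_zero_symm hfg
  set p : ℝ × ℝ → ℝ := fun x => lengthFactor f g s₀ |a| (ν x) with hpdef
  set q : ℝ × ℝ → ℝ := fun x => lengthFactor g f s₀ |b| (ν x) with hqdef
  have p0 : ∀ x, 0 < p x := fun x => lengthFactor_pos f g s₀ ha' (ν x)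
  have q0 : ∀ x, 0 < q x := fun x => lengthFactor_pos g f s₀ hb' (ν x)
  have cν : ContDiffOn ℝ m ν U := hν.of_le le_self_add
  obtain ⟨cνu, cνv⟩ := contDiffOn_partials hν hU
  have cp : ContDiffOn ℝ ((m : WithTop ℕ∞) + 1) p U :=
    (contDiffOn_lengthFactor hI hIc hf hg hfg hs₀ ha').comp hν hνI
  have cq : ContDiffOn ℝ ((m : WithTop ℕ∞) + 1) q U :=
    (contDiffOn_lengthFactor hI hIc hg hf hgf hs₀ hb').comp hν hνI
  have cfν : ContDiffOn ℝ ((m : WithTop ℕ∞) + 1) (fun x => f (ν x)) U := hf.comp hν hνI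
  have cgν : ContDiffOn ℝ ((m : WithTop ℕ∞) + 1) (fun x => g (ν x)) U := hg.comp hν hνI
  have cα : ContDiffOn ℝ m (fun x => factorRatio f g s₀ |a| |b| (ν x) * pv ν x) U :=
    ((contDiffOn_factorRatio hI hIc hf hg hfg hs₀ ha' hb').comp cν hνI).mul cνv
  have cγ : ContDiffOn ℝ m (fun x => factorRatio g f s₀ |b| |a| (ν x) * pu ν x) U :=
    ((contDiffOn_factorRatio hI hIc hg hf hgf hs₀ hb' ha').comp cν hνI).mul cνu
  have dν := fun x hx => hasPartials_of_contDiffOn hν (by simp) hU (p := x) hx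
  have dp := fun x hx => (dν x hx).scomp
    (hasDerivAt_lengthFactor hI hIc hf hg hfg hs₀ ha' (hνI x hx))
  have dq := fun x hx => (dν x hx).scomp
    (hasDerivAt_lengthFactor hI hIc hg hf hgf hs₀ hb' (hνI x hx))
  have df := fun x hx => ((hf.differentiableOn (by simp)).differentiableAt
    (hI.mem_nhds (hνI x hx))).hasDerivAt
  have dg := fun x hx => ((hg.differentiableOn (by simp)).differentiableAt
    (hI.mem_nhds (hνI x hx))).hasDerivAt
  have pvp : ∀ x ∈ U, pv p x = -(deriv f (ν x) / (f (ν x) - g (ν x))) * p x * pv ν x :=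
    fun x hx => (dp x hx).pv_eq
  have puq : ∀ x ∈ U, pu q x = -(deriv g (ν x) / (g (ν x) - f (ν x))) * q x * pu ν x :=
    fun x hx => (dq x hx).pu_eq
  obtain ⟨r, hr, hsub, z, X, Y, l, F, cz⟩ := exists_frameField hU hm (p := p) (q := q)
    (α := fun x => factorRatio f g s₀ |a| |b| (ν x) * pv ν x)
    (β := fun x => f (ν x) * p x)
    (γ := fun x => factorRatio g f s₀ |b| |a| (ν x) * pu ν x)
    (δ := fun x => g (ν x) * q x) cp cq cα ((cfν.mul cp).of_le le_self_add) cγ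
    ((cgν.mul cq).of_le le_self_add)
    (fun x hx => by
      have := (q0 x).ne'
      rw [pvp x hx, factorRatio, show lengthFactor g f s₀ |b| (ν x) = q x from rfl,
        show lengthFactor f g s₀ |a| (ν x) = p x from rfl]
      field_simp)
    (fun x hx => by
      have := (p0 x).ne'
      rw [puq x hx, factorRatio, show lengthFactor g f s₀ |b| (ν x) = q x from rfl,
        show lengthFactor f g s₀ |a| (ν x) = p x from rfl]
      field_simp)
    (fun x hx => by
      have := (q0 x).ne'
      have := hfg _ (hνI x hx)
      rw [(((dν x hx).scomp (df x hx)).mul (dp x hx)).pv_eq, factorRatio,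
        show lengthFactor g f s₀ |b| (ν x) = q x from rfl,
        show lengthFactor f g s₀ |a| (ν x) = p x from rfl]
      field_simp
      ring)
    (fun x hx => by
      have := (p0 x).ne'
      have := hgf _ (hνI x hx)
      rw [(((dν x hx).scomp (dg x hx)).mul (dq x hx)).pu_eq, factorRatio,
        show lengthFactor g f s₀ |b| (ν x) = q x from rfl,
        show lengthFactor f g s₀ |a| (ν x) = p x from rfl]
      field_simp
      ring)
    (fun x hx => by
      have hn := hfg _ (hνI x hx)
      have e := hpde x hx
      have dνv := hasPartials_of_contDiffOn cνv hm0 hU hx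
      have dνu := hasPartials_of_contDiffOn cνu hm0 hU hx
      have hφ := weight_pos f g s₀ (ν x)
      have hψ := weight_pos g f s₀ (ν x)
      rw [(((dν x hx).scomp (hasDerivAt_factorRatio hI hIc hm hf hg hfg hs₀ ha' hb'
        (hνI x hx))).mul dνv).pv_eq, (((dν x hx).scomp (hasDerivAt_factorRatio hI hIc hm hg hf hgf
        hs₀ hb' ha' (hνI x hx))).mul dνu).pu_eq]
      unfold NaturalPDE at e
      rw [← sq_abs a, ← sq_abs b] at e
      simp only [factorRatio, lengthFactor, hpdef, hqdef]
      rw [show g (ν x) - f (ν x) = -(f (ν x) - g (ν x)) by ring] at e ⊢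
      generalize weight f g s₀ (ν x) = φ at *
      generalize weight g f s₀ (ν x) = ψ at *
      generalize |a| = A at *
      generalize |b| = B at *
      generalize f (ν x) - g (ν x) = w at *
      -- With `1 / p = A φ` and `1 / q = B ψ`, the Gauss equation times `(f - g) / (p q)` is the
      -- natural equation.
      field_simp at e ⊢
      linarith)
    hx₀
  refine ⟨r, hr, hsub, z, cz, ?_⟩
  have inv := fun x hx => F.invariants Metric.isOpen_ball (fun x _ => p0 x) (fun x _ => q0 x)
    (fun x hx => hasPartials_of_contDiffOn cp (by simp) hU (hsub hx))
    (fun x hx => hasPartials_of_contDiffOn cq (by simp) hU (hsub hx)) (x := x) hx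
  have wein : IsWeingarten f g ν (Metric.ball x₀ r) z := by
    intro x hx
    rw [(inv x hx).2.1, (inv x hx).2.2.1, mul_div_cancel_right₀ _ (p0 x).ne',
      mul_div_cancel_right₀ _ (q0 x).ne']
    exact ⟨rfl, rfl⟩
  have g1 : ∀ x ∈ Metric.ball x₀ r, geod1 z x =
      weight g f s₀ (ν x) * (-|b| * deriv f (ν x) / (f (ν x) - g (ν x))) * pv ν x := by
    intro x hx
    have := (p0 x).ne'
    have := weight_pos g f s₀ (ν x)
    have := hfg _ (hνI x (hsub hx))
    rw [(inv x hx).2.2.2.1, pvp x (hsub hx), show q x = (|b| * weight g f s₀ (ν x))⁻¹ from rfl]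
    field_simp
  have g2 : ∀ x ∈ Metric.ball x₀ r, geod2 z x =
      weight f g s₀ (ν x) * (-|a| * deriv g (ν x) / (f (ν x) - g (ν x))) * pu ν x := by
    intro x hx
    have := (q0 x).ne'
    have := weight_pos f g s₀ (ν x)
    have := hfg _ (hνI x (hsub hx))
    rw [(inv x hx).2.2.2.2, puq x (hsub hx), show p x = (|a| * weight f g s₀ (ν x))⁻¹ from rfl,
      show g (ν x) - f (ν x) = -(f (ν x) - g (ν x)) by ring]
    field_simp
  refine ⟨⟨⟨?_, fun x hx => ?_, fun x hx => ?_, fun x hx => (inv x hx).1.2.2.1,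
    fun x hx => (inv x hx).1.2.2.2⟩, fun x hx => ?_⟩, wein, g1, g2⟩
  · refine cz.of_le ?_
    have h1 : (1 : WithTop ℕ∞) ≤ m := by exact_mod_cast hm
    calc (3 : WithTop ℕ∞) = 1 + 1 + 1 := by norm_num
      _ ≤ m + 1 + 1 := by gcongr
  · rw [(inv x hx).1.1]; exact neg_neg_of_pos (pow_pos (p0 x) 2)
  · rw [(inv x hx).1.2.1]; exact pow_pos (q0 x) 2
  · have hs := hνI x (hsub hx)
    have n := hfg _ hs
    have nf := left_ne_zero_of_mul (hfg' _ hs)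
    have ng := right_ne_zero_of_mul (hfg' _ hs)
    have nu := left_ne_zero_of_mul (hν' x (hsub hx))
    have nv := right_ne_zero_of_mul (hν' x (hsub hx))
    rw [(wein x hx).1, (wein x hx).2, g1 x hx, g2 x hx]
    exact mul_ne_zero (mul_ne_zero n (mul_ne_zero (mul_ne_zero (weight_pos g f s₀ _).ne'
      (div_ne_zero (mul_ne_zero (neg_ne_zero.2 hb'.ne') nf) n)) nv))
      (mul_ne_zero (mul_ne_zero (weight_pos f g s₀ _).ne'
      (div_ne_zero (mul_ne_zero (neg_ne_zero.2 ha'.ne') ng) n)) nu)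

end NaturalParameters

end Minkowski

end

theorem theorem3p6 (k : ℕ∞) (hk : 2 ≤ k)
    (I : Set ℝ) (hI : IsOpen I) (hIc : I.OrdConnected)
    (f g : ℝ → ℝ) (hf : ContDiffOn ℝ k f I) (hg : ContDiffOn ℝ k g I)
    (hfg : ∀ s ∈ I, f s - g s ≠ 0) (hfg' : ∀ s ∈ I, deriv f s * deriv g s ≠ 0)
    (D : Set (ℝ × ℝ)) (hD : IsOpen D)
    (ν : ℝ × ℝ → ℝ) (hν : ContDiffOn ℝ k ν D) (hνI : ∀ p ∈ D, ν p ∈ I)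
    (hν' : ∀ p ∈ D, Minkowski.pu ν p * Minkowski.pv ν p ≠ 0)
    (p₀ : ℝ × ℝ) (hp₀ : p₀ ∈ D)
    (a b : ℝ) (ha : a ≠ 0) (hb : b ≠ 0)
    (hpde : ∀ p ∈ D, Minkowski.NaturalPDE f g ν (ν p₀) a b p) :
    -- existence near `p₀`
    (∃ D₀ : Set (ℝ × ℝ), IsOpen D₀ ∧ IsConnected D₀ ∧ p₀ ∈ D₀ ∧ D₀ ⊆ D ∧
      ∃ z : ℝ × ℝ → Minkowski.R31, ContDiffOn ℝ ((k + 1 : ℕ∞) : WithTop ℕ∞) z D₀ ∧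
        Minkowski.IsSolution f g ν (ν p₀) a b D₀ z) ∧
    -- uniqueness up to a motion, over every subdomain of `D`
    (∀ D₁ : Set (ℝ × ℝ), IsOpen D₁ → IsConnected D₁ → D₁ ⊆ D →
      ∀ z w : ℝ × ℝ → Minkowski.R31,
        Minkowski.IsSolution f g ν (ν p₀) a b D₁ z →
        Minkowski.IsSolution f g ν (ν p₀) a b D₁ w →
        ∃ T : Minkowski.R31 → Minkowski.R31, Minkowski.IsMotion T ∧ ∀ p ∈ D₁, w p = T (z p)) ∧
    -- on every such surface the parameters are natural
    (∀ D₁ : Set (ℝ × ℝ), IsOpen D₁ → IsConnected D₁ → D₁ ⊆ D →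
      ∀ z : ℝ × ℝ → Minkowski.R31,
        Minkowski.IsSolution f g ν (ν p₀) a b D₁ z →
        Minkowski.IsNatural f g ν (ν p₀) D₁ z) := by

  -- The coefficients `α` and `γ` contain first derivatives of `f`, `g`, `ν`, so they have one order
  -- less, `m = k - 1`; for `k = ∞` this is again `∞`.
  obtain ⟨m, rfl⟩ : ∃ m : ℕ∞, k = m + 1 :=
    ⟨k - 1, (tsub_add_cancel_of_le (one_le_two.trans hk)).symm⟩
  have hm : 1 ≤ m := by
    have : (1 : ℕ∞) + 1 ≤ m + 1 := by simpa [one_add_one_eq_two] using hk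
    exact (ENat.add_le_add_iff_right ENat.one_ne_top).1 this
  push_cast at hf hg hν ⊢
  refine ⟨?_, fun D₁ hD₁ hc hsub z w hz hw => ?_, fun D₁ hD₁ hc hsub z hz => ?_⟩
  · obtain ⟨r, hr, hsub, z, cz, hz⟩ := Minkowski.exists_isSolution hm hI hIc hf hg hfg hfg' hD hν
      hνI hν' (hνI p₀ hp₀) ha hb hpde hp₀
    exact ⟨Metric.ball p₀ r, Metric.isOpen_ball,
      ⟨⟨p₀, Metric.mem_ball_self hr⟩, (convex_ball p₀ r).isPreconnected⟩,
      Metric.mem_ball_self hr, hsub, z, cz, hz⟩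
  · exact hz.exists_motion hI hf hg hfg hfg' hD₁ hc (hν.mono hsub) (fun x hx => hνI x (hsub hx))
      (fun x hx => hν' x (hsub hx)) ha hb hw
  · exact hz.isNatural hI hf hg hfg hfg' hD₁ (hν.mono hsub) (fun x hx => hνI x (hsub hx))
      (fun x hx => hν' x (hsub hx)) ha hb
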